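/- A pentagon is a simple closed polygon in the Euclidean plane with five vertices, together with the closed region it bounds; it need not be convex, and interior angles equal to $\pi$ are allowed. A unit-area Cairo (respectively Prismatic) pentagon is a unit-area pentagon circumscribed about a circle with three angles $2\pi/3$ and two nonadjacent (respectively adjacent) right angles; both have perimeter $2\sqrt{2+\sqrt3}$. A unit-area pentagon is called efficient if its perimeter is at most that of a unit-area Cairo pentagon. A non-convex pentagon is of Type 1 if exactly one of its interior angles is larger than $\pi$, and of Type 2 if exactly two of its interior angles are larger than $\pi$, these two having average less than $3\pi/2$. Let $T$ be an edge-to-edge tiling of the plane by unit-area pentagons: the tiles cover the plane, have pairwise disjoint interiors, and any two of them meet only along entire common edges or at common vertices. The perimeter ratio of $T$ is $$ \rho=\limsup_{R\to\infty}\frac{P(R)}{\pi R^2}\in[0,\infty], $$ where $P(R)$ is the total length of the part of the union of all tile boundaries that lies in the disk of radius $R$ about the origin (an edge shared by two tiles is counted once). For $R>0$ let $C_1(R)$, $N_1(R)$ and $N_2(R)$ be the fractions, among the tiles completely inside the disk of radius $R$ about the origin, of the efficient, the Type 1 non-convex and the Type 2 non-convex tiles, respectively (taken to be $0$ if no tile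 lies inside the disk). If $\rho$ is at most half the perimeter of a unit-area Prismatic pentagon, i.e. $\rho\le\sqrt{2+\sqrt3}$, then $$ \liminf_{R\to\infty}\bigl(C_1(R)-2.6\,N_1(R)-13.4\,N_2(R)\bigr)\ \ge\ 0 . $$ -/

import Mathlib

open MeasureTheory Filter Set Topology
open scoped ENNReal Real

noncomputable section

namespace PentagonTilings

/-! The Euclidean plane is `ℂ`: the distance is the Euclidean one, `volume` is area, and the
one-dimensional Hausdorff measure `μH[1]` is length. -/

/-- The perimeter of a polygon: the sum of the lengths of its edges. -/
def perimeter {n : ℕ} (P : Polygon ℂ n) : ℝ :=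
  ∑ i, dist (P i) (P (finRotate n i))

/-- A (not necessarily convex) simple pentagon in the plane, together with the closed region that it
bounds. Distinct edges meet at most in common vertices. The region is the compact regular closed set
whose frontier is the polygon; by the Jordan curve theorem it is the union of the polygon and of the
bounded component of its complement. Angles equal to `π` are allowed. -/
structure Pentagon where
  /-- The closed polygon with its five vertices, in cyclic order. -/
  poly : Polygon ℂ 5
  /-- The closed region bounded by the polygon. -/
  region : Set ℂ
  vertices_injective : Function.Injective poly.vertices
  simple : ∀ i j, i ≠ j → poly.edgeSet ℝ i ∩ poly.edgeSet ℝ j ⊆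
    {poly i, poly (finRotate 5 i)} ∩ {poly j, poly (finRotate 5 j)}
  isCompact_region : IsCompact region
  closure_interior_region : closure (interior region) = region
  frontier_region : frontier region = poly.boundary ℝ

/-- The interior angle at the `k`-th vertex: the angular measure of the set of directions that point
from the vertex into the region. -/
def Pentagon.interiorAngle (P : Pentagon) (k : Fin 5) : ℝ :=
  (volume {φ : ℝ | φ ∈ Ioc (-π) π ∧
    ∀ᶠ r : ℝ in 𝓝[>] 0, P.poly k + r * Complex.exp (φ * Complex.I) ∈ P.region}).toReal

/-- The inradius of the unit-area Cairo and Prismatic pentagons. -/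
def inradius : ℝ := 1 / √(2 + √3)

/-- The unit-area Prismatic pentagon: it is circumscribed about the circle of radius `inradius` about
the origin and has angles `π/2, π/2, 2π/3, 2π/3, 2π/3`, in this cyclic order. -/
def prismatic : Polygon ℂ 5 where
  vertices := ![⟨-inradius, -inradius⟩, ⟨inradius, -inradius⟩, ⟨inradius, inradius / √3⟩,
    ⟨0, 2 * inradius / √3⟩, ⟨-inradius, inradius / √3⟩]

/-- The unit-area Cairo pentagon: it is circumscribed about the circle of radius `inradius` about
the origin and has angles `2π/3, π/2, 2π/3, 2π/3, π/2`, in this cyclic order. -/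
def cairo : Polygon ℂ 5 where
  vertices := ![⟨0, -(2 * inradius / √3)⟩,
    ⟨inradius * (√3 + 1) / 2, -(inradius * (√3 - 1) / 2)⟩, ⟨inradius / √3, inradius⟩,
    ⟨-(inradius / √3), inradius⟩, ⟨-(inradius * (√3 + 1) / 2), -(inradius * (√3 - 1) / 2)⟩]

/-- A pentagon (of unit area) is efficient if its perimeter is at most that of a Cairo pentagon. -/
def Pentagon.IsEfficient (P : Pentagon) : Prop :=
  volume P.region = 1 ∧ perimeter P.poly ≤ perimeter cairo

/-- Type 1: a non-convex pentagon with exactly one interior angle larger than `π`. -/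
def Pentagon.IsType1 (P : Pentagon) : Prop :=
  ¬ Convex ℝ P.region ∧ ∃ j, {k | π < P.interiorAngle k} = {j}

/-- Type 2: a non-convex pentagon with exactly two interior angles larger than `π`, whose average is
less than `3π/2`. -/
def Pentagon.IsType2 (P : Pentagon) : Prop :=
  ¬ Convex ℝ P.region ∧ ∃ i j, i ≠ j ∧ {k | π < P.interiorAngle k} = {i, j} ∧
    (P.interiorAngle i + P.interiorAngle j) / 2 < 3 * π / 2

/-- An edge-to-edge tiling of the plane by unit-area pentagons. -/
structure PentagonTiling (ι : Type*) where
  /-- The tiles. -/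
  tile : ι → Pentagon
  unit_area : ∀ i, volume (tile i).region = 1
  cover : ⋃ i, (tile i).region = univ
  disjoint_interiors : ∀ i j, i ≠ j →
    Disjoint (interior (tile i).region) (interior (tile j).region)
  /-- Two tiles meet only along entire common edges or at common vertices. -/
  edge_to_edge : ∀ i j, i ≠ j → ∀ p ∈ (tile i).region ∩ (tile j).region,
    (∃ k l, (tile i).poly k = p ∧ (tile j).poly l = p) ∨
    (∃ k l, (tile i).poly.edgeSet ℝ k = (tile j).poly.edgeSet ℝ l ∧
      p ∈ (tile i).poly.edgeSet ℝ k)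

variable {ι : Type*}

/-- The union of the boundaries of all tiles. -/
def PentagonTiling.skeleton (T : PentagonTiling ι) : Set ℂ :=
  ⋃ i, (T.tile i).poly.boundary ℝ

/-- The perimeter ratio: the limit superior, as `R → ∞`, of the perimeter of the tiling inside the
disk of radius `R` about the origin divided by `π R ^ 2`, as an extended nonnegative number. (An edge
shared by two tiles is counted once.) -/
def PentagonTiling.perimeterRatio (T : PentagonTiling ι) : ℝ≥0∞ :=
  limsup (fun R : ℝ => μH[1] (T.skeleton ∩ Metric.closedBall 0 R) / ENNReal.ofReal (π * R ^ 2))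
    atTop

/-- The tiles completely inside the disk of radius `R` about the origin. -/
def PentagonTiling.inside (T : PentagonTiling ι) (R : ℝ) : Set ι :=
  {i | (T.tile i).region ⊆ Metric.closedBall 0 R}

/-- The fraction of the tiles completely inside the disk of radius `R` about the origin that have the
property `S`. It lies in `[0, 1]`. -/
def PentagonTiling.fraction (T : PentagonTiling ι) (S : Pentagon → Prop) (R : ℝ) : ℝ :=
  ({i ∈ T.inside R | S (T.tile i)}.ncard : ℝ) / ((T.inside R).ncard : ℝ)

section Perimeters

theorem inradius_pos : 0 < inradius := by
  unfold inradius
  positivity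

theorem dist_eq_of_sq {a b c d l : ℝ} (hl : 0 ≤ l) (h : (a - c) ^ 2 + (b - d) ^ 2 = l ^ 2) :
    dist (⟨a, b⟩ : ℂ) ⟨c, d⟩ = l := by
  rw [Complex.dist_eq_re_im]
  simp only [h]
  exact Real.sqrt_sq hl

theorem inradius_mul : inradius * (2 + √3) = √(2 + √3) := by
  unfold inradius
  rw [one_div, inv_mul_eq_div]
  exact Real.div_sqrt

theorem perimeter_prismatic : perimeter prismatic = 2 * √(2 + √3) := by
  have h3 : √3 ^ 2 = 3 := Real.sq_sqrt (by norm_num)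
  have h0 : (0 : ℝ) < √3 := by positivity
  have hr := inradius_pos
  have e0 : dist (⟨-inradius, -inradius⟩ : ℂ) ⟨inradius, -inradius⟩ = 2 * inradius :=
    dist_eq_of_sq (by positivity) (by ring)
  have e1 : dist (⟨inradius, -inradius⟩ : ℂ) ⟨inradius, inradius / √3⟩
      = inradius * (1 + 1 / √3) := dist_eq_of_sq (by positivity) (by ring)
  have e2 : dist (⟨inradius, inradius / √3⟩ : ℂ) ⟨0, 2 * inradius / √3⟩
      = inradius * (2 / √3) := dist_eq_of_sq (by positivity) (by field_simp; rw [h3]; ring)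
  have e3 : dist (⟨0, 2 * inradius / √3⟩ : ℂ) ⟨-inradius, inradius / √3⟩
      = inradius * (2 / √3) := dist_eq_of_sq (by positivity) (by field_simp; rw [h3]; ring)
  have e4 : dist (⟨-inradius, inradius / √3⟩ : ℂ) ⟨-inradius, -inradius⟩
      = inradius * (1 + 1 / √3) := dist_eq_of_sq (by positivity) (by ring)
  simp only [perimeter, Fin.sum_univ_five, finRotate_apply]
  change dist (⟨-inradius, -inradius⟩ : ℂ) ⟨inradius, -inradius⟩
    + dist (⟨inradius, -inradius⟩ : ℂ) ⟨inradius, inradius / √3⟩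
    + dist (⟨inradius, inradius / √3⟩ : ℂ) ⟨0, 2 * inradius / √3⟩
    + dist (⟨0, 2 * inradius / √3⟩ : ℂ) ⟨-inradius, inradius / √3⟩
    + dist (⟨-inradius, inradius / √3⟩ : ℂ) ⟨-inradius, -inradius⟩ = _
  rw [e0, e1, e2, e3, e4, ← inradius_mul]
  field_simp
  linarith

theorem perimeter_cairo : perimeter cairo = 2 * √(2 + √3) := by
  have h3 : √3 ^ 2 = 3 := Real.sq_sqrt (by norm_num)
  have h0 : (0 : ℝ) < √3 := by positivity
  have h4 : 1 / √3 = √3 / 3 := by field_simp; linarith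
  have hr := inradius_pos
  have d0 : ∀ x : ℝ, x / √3 = x * (√3 / 3) := fun x => by rw [← h4]; ring
  have e0 : dist (⟨0, -(2 * inradius / √3)⟩ : ℂ)
      ⟨inradius * (√3 + 1) / 2, -(inradius * (√3 - 1) / 2)⟩ = inradius * (1 + √3 / 3) :=
    dist_eq_of_sq (by positivity)
      (by rw [d0]; linear_combination (inradius ^ 2 * (1 / 6)) * h3)
  have e1 : dist (⟨inradius * (√3 + 1) / 2, -(inradius * (√3 - 1) / 2)⟩ : ℂ)
      ⟨inradius / √3, inradius⟩ = inradius * (1 + √3 / 3) :=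
    dist_eq_of_sq (by positivity)
      (by rw [d0]; linear_combination (inradius ^ 2 * (1 / 6)) * h3)
  have e2 : dist (⟨inradius / √3, inradius⟩ : ℂ) ⟨-(inradius / √3), inradius⟩
      = 2 * inradius * (√3 / 3) :=
    dist_eq_of_sq (by positivity) (by rw [d0]; ring)
  have e3 : dist (⟨-(inradius / √3), inradius⟩ : ℂ)
      ⟨-(inradius * (√3 + 1) / 2), -(inradius * (√3 - 1) / 2)⟩ = inradius * (1 + √3 / 3) :=
    dist_eq_of_sq (by positivity)
      (by rw [d0]; linear_combination (inradius ^ 2 * (1 / 6)) * h3)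
  have e4 : dist (⟨-(inradius * (√3 + 1) / 2), -(inradius * (√3 - 1) / 2)⟩ : ℂ)
      ⟨0, -(2 * inradius / √3)⟩ = inradius * (1 + √3 / 3) :=
    dist_eq_of_sq (by positivity)
      (by rw [d0]; linear_combination (inradius ^ 2 * (1 / 6)) * h3)
  simp only [perimeter, Fin.sum_univ_five, finRotate_apply]
  change dist (⟨0, -(2 * inradius / √3)⟩ : ℂ)
      ⟨inradius * (√3 + 1) / 2, -(inradius * (√3 - 1) / 2)⟩
    + dist (⟨inradius * (√3 + 1) / 2, -(inradius * (√3 - 1) / 2)⟩ : ℂ)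
      ⟨inradius / √3, inradius⟩
    + dist (⟨inradius / √3, inradius⟩ : ℂ) ⟨-(inradius / √3), inradius⟩
    + dist (⟨-(inradius / √3), inradius⟩ : ℂ)
      ⟨-(inradius * (√3 + 1) / 2), -(inradius * (√3 - 1) / 2)⟩
    + dist (⟨-(inradius * (√3 + 1) / 2), -(inradius * (√3 - 1) / 2)⟩ : ℂ)
      ⟨0, -(2 * inradius / √3)⟩ = _
  rw [e0, e1, e2, e3, e4, ← inradius_mul]
  ring

end Perimeters

end PentagonTilings

end

/-!
Among closed paths through `n` points the regular `n`-gon encloses the largest area for its length.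
So a pentagon of unit area has at least the perimeter `3.8119` of a regular pentagon. A vertex with
a reflex angle is not a corner of the convex hull; hence one such vertex improves the bound to the
perimeter `4` of a square, and two of them to the perimeter `4.559` of a regular triangle. The
excess of the perimeter over that of a Cairo pentagon is therefore, up to a common factor, at least
`-1` for an efficient pentagon, `2.6` for Type 1, `13.4` for Type 2, and `0` for the others. All but
countably many points of the skeleton lie on at most two tiles, and a tile that meets a disk without
lying in a larger concentric one has a long boundary inside the latter. So the bound on the
perimeter ratio says that the average excess of the tiles inside a large disk is asymptotically at
most `0`.
-/

noncomputable section

namespace PentagonTilings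

/-! ### The discrete Wirtinger inequality -/

theorem two_mul_mul_le_div_mul_sq_add {s t : ℝ} (hs : 0 < s) (ht : 0 < t) (x y : ℝ) :
    2 * (x * y) ≤ t / s * x ^ 2 + s / t * y ^ 2 := by
  have : t / s * x ^ 2 + s / t * y ^ 2 - 2 * (x * y) = (t * x - s * y) ^ 2 / (s * t) := by
    field_simp
    ring
  have : 0 ≤ (t * x - s * y) ^ 2 / (s * t) := by positivity
  linarith

theorem sum_mul_succ_le_of_eq_zero {n : ℕ} (hn : n ≠ 0) {y : ℕ → ℝ} (h₀ : y 0 = 0) (hₙ : y n = 0) :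
    ∑ j ∈ Finset.range n, y j * y (j + 1) ≤
      Real.cos (π / n) * ∑ j ∈ Finset.range n, y j ^ 2 := by
  obtain ⟨m, rfl⟩ := Nat.exists_eq_succ_of_ne_zero hn
  set θ : ℝ := π / (m + 1 : ℕ) with hθ
  have hmθ : ((m + 1 : ℕ) : ℝ) * θ = π := by rw [hθ]; field_simp
  set s : ℕ → ℝ := fun j => Real.sin (j * θ) with hs
  have s_rec (j : ℕ) : s (j + 2) = 2 * Real.cos θ * s (j + 1) - s j := by
    have hj : (j : ℝ) * θ = (j + 1 : ℕ) * θ - θ := by push_cast; ring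
    have hj' : ((j + 2 : ℕ) : ℝ) * θ = (j + 1 : ℕ) * θ + θ := by push_cast; ring
    simp only [hs, hj, hj', Real.sin_add, Real.sin_sub]
    ring
  have s_pos {j : ℕ} (hj : j ≠ 0) (hjm : j ≤ m) : 0 < s j := by
    refine Real.sin_pos_of_pos_of_lt_pi (by positivity) (hmθ ▸ ?_)
    gcongr
    omega
  -- Completing the square in the variables `y 1`, `y 2`, … one after the other.
  have partial_bound (k : ℕ) (hk : k ≤ m) : s (k + 1) / s k * y k ^ 2 ≤
      2 * Real.cos θ * ∑ j ∈ Finset.range (k + 1), y j ^ 2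
        - 2 * ∑ j ∈ Finset.range k, y j * y (j + 1) := by
    induction k with
    | zero => simp [h₀]
    | succ k ih =>
      have hsquare : 2 * (y k * y (k + 1)) ≤
          s (k + 1) / s k * y k ^ 2 + s k / s (k + 1) * y (k + 1) ^ 2 := by
        rcases eq_or_ne k 0 with rfl | hk₀
        · simp [h₀, hs]
        · exact two_mul_mul_le_div_mul_sq_add (s_pos hk₀ (by omega)) (s_pos k.succ_ne_zero hk) _ _
      have hcoeff : s (k + 1 + 1) / s (k + 1) = 2 * Real.cos θ - s k / s (k + 1) := by
        rw [s_rec k, sub_div, mul_div_cancel_right₀ _ (s_pos k.succ_ne_zero hk).ne']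
      rw [Finset.sum_range_succ, Finset.sum_range_succ (fun j => y j * y (j + 1)), hcoeff]
      linarith [ih (by omega)]
  have hm := partial_bound m le_rfl
  rw [show s (m + 1) = 0 by simp only [hs, hmθ, Real.sin_pi], zero_div, zero_mul] at hm
  rw [Finset.sum_range_succ (fun j => y j * y (j + 1)), hₙ, mul_zero, add_zero]
  linarith

theorem sum_mul_succ_le_of_eq_neg {n : ℕ} (hn : n ≠ 0) {x : ℕ → ℝ} (hx : x n = -x 0) :
    ∑ j ∈ Finset.range n, x j * x (j + 1) ≤
      Real.cos (π / n) * ∑ j ∈ Finset.range n, x j ^ 2 := by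
  set θ : ℝ := π / n with hθ
  have hnθ : n * θ = π := by rw [hθ]; field_simp
  set c : ℕ → ℝ := fun j => Real.cos (j * θ) with hc
  have hcn : c n = -c 0 := by simp [hc, hnθ]
  -- The sequence `c` lies in the kernel of the form on antiperiodic sequences.
  have kernel (u : ℕ → ℝ) (hu : u n = -u 0) :
      ∑ j ∈ Finset.range n, (u j * c (j + 1) + c j * u (j + 1) - 2 * Real.cos θ * (c j * u j))
        = 0 := by
    have hsub (j : ℕ) : u j * c (j + 1) + c j * u (j + 1) - 2 * Real.cos θ * (c j * u j)
        = Real.cos ((j + 1 : ℕ) * θ - θ) * u (j + 1) - Real.cos (j * θ - θ) * u j := by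
      have hj : ((j + 1 : ℕ) : ℝ) * θ = j * θ + θ := by push_cast; ring
      simp only [hc, hj, add_sub_cancel_right, Real.cos_add, Real.cos_sub]
      ring
    rw [Finset.sum_congr rfl fun j _ => hsub j,
      Finset.sum_range_sub (fun j : ℕ => Real.cos (j * θ - θ) * u j), hnθ, hu, Real.cos_pi_sub]
    simp
  have hmain := sum_mul_succ_le_of_eq_zero hn (y := fun j => x j - x 0 * c j)
    (by simp [hc]) (by rw [hcn, hx]; simp [hc])
  have hexpand : Real.cos θ * ∑ j ∈ Finset.range n, (x j - x 0 * c j) ^ 2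
        - ∑ j ∈ Finset.range n, (x j - x 0 * c j) * (x (j + 1) - x 0 * c (j + 1))
        - (Real.cos θ * ∑ j ∈ Finset.range n, x j ^ 2 - ∑ j ∈ Finset.range n, x j * x (j + 1))
      = x 0 * ∑ j ∈ Finset.range n,
          (x j * c (j + 1) + c j * x (j + 1) - 2 * Real.cos θ * (c j * x j))
        - x 0 ^ 2 / 2 * ∑ j ∈ Finset.range n,
          (c j * c (j + 1) + c j * c (j + 1) - 2 * Real.cos θ * (c j * c j)) := by
    simp only [Finset.mul_sum, ← Finset.sum_sub_distrib]
    exact Finset.sum_congr rfl fun j _ => by ring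
  rw [kernel x hx, kernel c hcn] at hexpand
  linarith

theorem sum_re_add_sum_im_le_of_periodic {n : ℕ} (hn : n ≠ 0) {ζ : ℕ → ℂ} (hζ : ζ n = ζ 0) :
    Real.cos (π / n) *
        ∑ j ∈ Finset.range n, ((ζ j).re * (ζ (j + 1)).re + (ζ j).im * (ζ (j + 1)).im)
      + Real.sin (π / n) *
        ∑ j ∈ Finset.range n, ((ζ j).re * (ζ (j + 1)).im - (ζ j).im * (ζ (j + 1)).re)
      ≤ Real.cos (π / n) * ∑ j ∈ Finset.range n, ((ζ j).re ^ 2 + (ζ j).im ^ 2) := by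
  set θ : ℝ := π / n with hθ
  have hnθ : n * θ = π := by rw [hθ]; field_simp
  -- The coordinates of `exp (-i j θ) * ζ j`, an antiperiodic sequence.
  set x : ℕ → ℝ := fun j => Real.cos (j * θ) * (ζ j).re + Real.sin (j * θ) * (ζ j).im with hx
  set y : ℕ → ℝ := fun j => Real.cos (j * θ) * (ζ j).im - Real.sin (j * θ) * (ζ j).re with hy
  have hxn : x n = -x 0 := by simp [hx, hnθ, hζ]
  have hyn : y n = -y 0 := by simp [hy, hnθ, hζ]
  have hrot := add_le_add (sum_mul_succ_le_of_eq_neg hn hxn) (sum_mul_succ_le_of_eq_neg hn hyn)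
  have hsq (j : ℕ) : x j ^ 2 + y j ^ 2 = (ζ j).re ^ 2 + (ζ j).im ^ 2 := by
    simp only [hx, hy]
    linear_combination ((ζ j).re ^ 2 + (ζ j).im ^ 2) * Real.cos_sq_add_sin_sq (j * θ)
  have hprod (j : ℕ) : x j * x (j + 1) + y j * y (j + 1) =
      Real.cos θ * ((ζ j).re * (ζ (j + 1)).re + (ζ j).im * (ζ (j + 1)).im)
        + Real.sin θ * ((ζ j).re * (ζ (j + 1)).im - (ζ j).im * (ζ (j + 1)).re) := by
    have hj : ((j + 1 : ℕ) : ℝ) * θ = j * θ + θ := by push_cast; ring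
    simp only [hx, hy, hj, Real.cos_add, Real.sin_add]
    linear_combination (Real.cos θ * ((ζ j).re * (ζ (j + 1)).re + (ζ j).im * (ζ (j + 1)).im)
      + Real.sin θ * ((ζ j).re * (ζ (j + 1)).im - (ζ j).im * (ζ (j + 1)).re))
        * Real.cos_sq_add_sin_sq (j * θ)
  rwa [← mul_add, ← Finset.sum_add_distrib, ← Finset.sum_add_distrib,
    Finset.sum_congr rfl fun j _ => hsq j, Finset.sum_congr rfl fun j _ => hprod j,
    Finset.sum_add_distrib, ← Finset.mul_sum, ← Finset.mul_sum] at hrot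

theorem dist_sq_eq (u v : ℂ) : dist u v ^ 2 = (u.re - v.re) ^ 2 + (u.im - v.im) ^ 2 := by
  rw [Complex.dist_eq_re_im, Real.sq_sqrt (by positivity)]

section ClosedPaths

variable {n : ℕ} [NeZero n]

/-- The length of the closed path through the points `z 0, …, z (n - 1)`. -/
def pathLength (z : Fin n → ℂ) : ℝ := ∑ i, dist (z i) (z (i + 1))

/-- The sum of the squares of the edge lengths of a closed path. -/
def sqLength (z : Fin n → ℂ) : ℝ := ∑ i, dist (z i) (z (i + 1)) ^ 2

/-- The signed area enclosed by a closed path, by the shoelace formula. -/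
def shoelace (z : Fin n → ℂ) : ℝ :=
  ∑ i, ((z i).re * (z (i + 1)).im - (z i).im * (z (i + 1)).re) / 2

theorem sum_edges_eq_sum_range (F : ℂ → ℂ → ℝ) (z : Fin n → ℂ) :
    ∑ i, F (z i) (z (i + 1)) =
      ∑ j ∈ Finset.range n, F (z (Fin.ofNat n j)) (z (Fin.ofNat n (j + 1))) := by
  have hval (i : Fin n) : Fin.ofNat n i = i := by simp
  have hsucc (i : Fin n) : Fin.ofNat n (i + 1) = i + 1 := by ext; simp [Fin.val_add]
  rw [← Fin.sum_univ_eq_sum_range fun j => F (z (Fin.ofNat n j)) (z (Fin.ofNat n (j + 1)))]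
  simp only [hval, hsucc]

theorem four_mul_tan_mul_shoelace_le (hn : 2 < n) (z : Fin n → ℂ) :
    4 * Real.tan (π / n) * shoelace z ≤ sqLength z := by
  have hcos : 0 < Real.cos (π / n) := by
    refine Real.cos_pos_of_mem_Ioo ⟨by linarith [Real.pi_pos, show 0 < π / n by positivity], ?_⟩
    gcongr
    exact_mod_cast hn
  set ζ : ℕ → ℂ := fun j => z (Fin.ofNat n j) with hζ
  have hζ_period : ζ n = ζ 0 := by simp [hζ]
  have hshift : ∑ j ∈ Finset.range n, ((ζ (j + 1)).re ^ 2 + (ζ (j + 1)).im ^ 2)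
      = ∑ j ∈ Finset.range n, ((ζ j).re ^ 2 + (ζ j).im ^ 2) := by
    rw [← sub_eq_zero, ← Finset.sum_sub_distrib,
      Finset.sum_range_sub (fun j => (ζ j).re ^ 2 + (ζ j).im ^ 2), hζ_period, sub_self]
  have hlength : sqLength z = 2 * ∑ j ∈ Finset.range n, ((ζ j).re ^ 2 + (ζ j).im ^ 2)
      - 2 * ∑ j ∈ Finset.range n, ((ζ j).re * (ζ (j + 1)).re + (ζ j).im * (ζ (j + 1)).im) := by
    rw [sqLength, sum_edges_eq_sum_range (fun u v => dist u v ^ 2), two_mul]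
    nth_rewrite 2 [← hshift]
    rw [Finset.mul_sum, ← Finset.sum_add_distrib, ← Finset.sum_sub_distrib]
    exact Finset.sum_congr rfl fun j _ => by rw [dist_sq_eq]; ring
  have harea : 2 * shoelace z =
      ∑ j ∈ Finset.range n, ((ζ j).re * (ζ (j + 1)).im - (ζ j).im * (ζ (j + 1)).re) := by
    rw [shoelace, sum_edges_eq_sum_range (fun u v => (u.re * v.im - u.im * v.re) / 2),
      ← Finset.sum_div, mul_div_cancel₀ _ two_ne_zero]
  have hmain := sum_re_add_sum_im_le_of_periodic (NeZero.ne n) hζ_period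
  rw [← harea] at hmain
  rw [hlength, Real.tan_eq_sin_div_cos, mul_div_assoc', div_mul_eq_mul_div, div_le_iff₀ hcos]
  linarith

/-! ### The isoperimetric inequality for closed paths -/

theorem sum_edges_update (hn : 1 < n) (F : ℂ → ℂ → ℝ) (z : Fin n → ℂ) (k : Fin n) (v : ℂ) :
    ∑ i, F (Function.update z k v i) (Function.update z k v (i + 1)) =
      ∑ i, F (z i) (z (i + 1)) - (F (z (k - 1)) (z k) + F (z k) (z (k + 1)))
        + (F (z (k - 1)) v + F v (z (k + 1))) := by
  have hpred : k - 1 ≠ k := by simpa using hn.ne'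
  have hsucc : k + 1 ≠ k := by simpa using hn.ne'
  have hchange : ∑ i, (F (Function.update z k v i) (Function.update z k v (i + 1))
        - F (z i) (z (i + 1)))
      = (F (z (k - 1)) v - F (z (k - 1)) (z k)) + (F v (z (k + 1)) - F (z k) (z (k + 1))) := by
    rw [Fintype.sum_eq_add (k - 1) k hpred]
    · simp only [sub_add_cancel, Function.update_self, Function.update_of_ne hpred,
        Function.update_of_ne hsucc]
    · rintro i ⟨hi, hik⟩
      rw [Function.update_of_ne hik,
        Function.update_of_ne fun h : i + 1 = k => hi (eq_sub_of_add_eq h), sub_self]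
  rw [Finset.sum_sub_distrib] at hchange
  linarith

/-- Twice the signed area of the triangle `a b c`; its sign tells on which side of the line `a b`
the point `c` lies. -/
def cross (a b c : ℂ) : ℝ := (b.re - a.re) * (c.im - a.im) - (b.im - a.im) * (c.re - a.re)

theorem four_mul_cross_sq_le (u v w : ℂ) :
    4 * cross u v w ^ 2 ≤ dist u w ^ 2 * ((dist u v + dist v w) ^ 2 - dist u w ^ 2) := by
  have hheron : 4 * cross u v w ^ 2 = 4 * dist u v ^ 2 * dist u w ^ 2
      - (dist u v ^ 2 + dist u w ^ 2 - dist v w ^ 2) ^ 2 := by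
    simp only [dist_sq_eq, cross]
    ring
  have htri : dist u w ^ 2 ≤ (dist u v + dist v w) ^ 2 := by
    gcongr
    exact dist_triangle u v w
  have := mul_nonneg (sub_nonneg.2 htri) (sq_nonneg (dist u v - dist v w))
  linarith

theorem exists_isosceles (u v w : ℂ) : ∃ v', dist u v' = (dist u v + dist v w) / 2 ∧
    dist v' w = (dist u v + dist v w) / 2 ∧ cross u v w ≤ cross u v' w := by
  set L := dist u v + dist v w with hL
  have hL₀ : 0 ≤ L := by positivity
  rcases eq_or_ne u w with rfl | huw
  · refine ⟨u + (L / 2 : ℝ), ?_, ?_, by simp [cross]⟩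
    · rw [dist_self_add_right, Complex.norm_of_nonneg (by positivity)]
    · rw [dist_self_add_left, Complex.norm_of_nonneg (by positivity)]
  set d := dist u w
  have hd₀ : 0 < d := dist_pos.2 huw
  have hd_sq : d ^ 2 = (u.re - w.re) ^ 2 + (u.im - w.im) ^ 2 := dist_sq_eq u w
  have hLd : d ^ 2 ≤ L ^ 2 := by gcongr; exact dist_triangle u v w
  -- The apex lies on the perpendicular bisector of `u w`.
  obtain ⟨t, ht₀, ht⟩ : ∃ t : ℝ, 0 ≤ t ∧ (1 / 4 + t ^ 2) * d ^ 2 = L ^ 2 / 4 := by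
    refine ⟨√((L ^ 2 - d ^ 2) / (4 * d ^ 2)), Real.sqrt_nonneg _, ?_⟩
    rw [Real.sq_sqrt (div_nonneg (sub_nonneg.2 hLd) (by positivity))]
    field_simp
    ring
  set v' : ℂ := ⟨(u.re + w.re) / 2 + t * (w.im - u.im), (u.im + w.im) / 2 - t * (w.re - u.re)⟩
    with hv'
  refine ⟨v', ?_, ?_, ?_⟩
  · rw [← sq_eq_sq₀ dist_nonneg (by positivity), dist_sq_eq]
    linear_combination ht - (1 / 4 + t ^ 2) * hd_sq
  · rw [← sq_eq_sq₀ dist_nonneg (by positivity), dist_sq_eq]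
    linear_combination ht - (1 / 4 + t ^ 2) * hd_sq
  · have hcross : cross u v' w = t * d ^ 2 := by rw [hd_sq, hv', cross]; ring
    rw [hcross]
    refine le_of_sq_le_sq ?_ (by positivity)
    linarith [four_mul_cross_sq_le u v w, show 4 * (t * d ^ 2) ^ 2 = d ^ 2 * (L ^ 2 - d ^ 2) by
      linear_combination 4 * d ^ 2 * ht]

theorem exists_update_isosceles (hn : 1 < n) (z : Fin n → ℂ) {k : Fin n}
    (h : dist (z (k - 1)) (z k) ≠ dist (z k) (z (k + 1))) :
    ∃ v, pathLength (Function.update z k v) = pathLength z ∧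
      shoelace z ≤ shoelace (Function.update z k v) ∧
      sqLength (Function.update z k v) < sqLength z := by
  obtain ⟨v, hleft, hright, hcross⟩ := exists_isosceles (z (k - 1)) (z k) (z (k + 1))
  refine ⟨v, ?_, ?_, ?_⟩
  · rw [pathLength, sum_edges_update hn dist, hleft, hright, pathLength]
    ring
  · rw [shoelace, shoelace, sum_edges_update hn fun u v => (u.re * v.im - u.im * v.re) / 2]
    simp only [cross] at hcross
    linarith
  · rw [sqLength, sqLength, sum_edges_update hn fun u v => dist u v ^ 2, hleft, hright]
    have := sq_pos_of_ne_zero (sub_ne_zero.2 h)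
    linarith

theorem pathLength_nonneg (z : Fin n → ℂ) : 0 ≤ pathLength z :=
  Finset.sum_nonneg fun _ _ => dist_nonneg

theorem dist_zero_le_pathLength (z : Fin n → ℂ) (i : Fin n) : dist (z 0) (z i) ≤ pathLength z := by
  rw [pathLength, sum_edges_eq_sum_range dist]
  calc dist (z 0) (z i)
      ≤ ∑ j ∈ Finset.range i, dist (z (Fin.ofNat n j)) (z (Fin.ofNat n (j + 1))) := by
        simpa using dist_le_range_sum_dist (fun j => z (Fin.ofNat n j)) i
    _ ≤ _ := Finset.sum_le_sum_of_subset_of_nonneg (Finset.range_mono i.is_lt.le)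
        fun _ _ _ => dist_nonneg

theorem isCompact_setOf_pathLength_le (a : ℂ) (L : ℝ) :
    IsCompact {w : Fin n → ℂ | w 0 = a ∧ pathLength w ≤ L} := by
  have hcont : Continuous (pathLength : (Fin n → ℂ) → ℝ) := by unfold pathLength; fun_prop
  refine Metric.isCompact_of_isClosed_isBounded ((isClosed_eq (continuous_apply 0)
    continuous_const).inter (isClosed_le hcont continuous_const))
    ((Metric.isBounded_closedBall (x := fun _ => a) (r := L)).subset ?_)
  rintro w ⟨rfl, hw⟩
  exact (dist_pi_le_iff ((pathLength_nonneg w).trans hw)).2 fun i =>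
    dist_comm (w 0) (w i) ▸ (dist_zero_le_pathLength w i).trans hw

theorem exists_equilateral (hn : 1 < n) (z : Fin n → ℂ) :
    ∃ w : Fin n → ℂ, pathLength w ≤ pathLength z ∧ shoelace z ≤ shoelace w ∧
      ∀ i, dist (w i) (w (i + 1)) = dist (w 0) (w 1) := by
  have hcont_area : Continuous (shoelace : (Fin n → ℂ) → ℝ) := by unfold shoelace; fun_prop
  have hcont_sq : Continuous (sqLength : (Fin n → ℂ) → ℝ) := by unfold sqLength; fun_prop
  -- Among the paths of largest area, one with the least sum of squares is equilateral.
  have hK := isCompact_setOf_pathLength_le (n := n) (z 0) (pathLength z)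
  obtain ⟨w₀, hw₀, hmax⟩ := hK.exists_isMaxOn ⟨z, rfl, le_rfl⟩ hcont_area.continuousOn
  obtain ⟨w, ⟨⟨hw_zero, hw_length⟩, hw_area⟩, hmin⟩ :=
    (hK.inter_right (isClosed_Ici.preimage hcont_area)).exists_isMinOn
      ⟨w₀, hw₀, self_mem_Ici⟩ hcont_sq.continuousOn
  refine ⟨w, hw_length, (hmax ⟨rfl, le_rfl⟩).trans hw_area, ?_⟩
  have hequal (k : Fin n) (hk : k ≠ 0) : dist (w (k - 1)) (w k) = dist (w k) (w (k + 1)) := by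
    by_contra hne
    obtain ⟨v, hlength, harea, hsq⟩ := exists_update_isosceles hn w hne
    refine hsq.not_ge (hmin ⟨⟨?_, hlength.trans_le hw_length⟩, hw_area.trans harea⟩)
    rw [Function.update_of_ne hk.symm, hw_zero]
  obtain ⟨m, rfl⟩ := Nat.exists_eq_succ_of_ne_zero (NeZero.ne n)
  intro i
  induction i using Fin.induction with
  | zero => simp
  | succ i ih =>
    rw [← ih, ← hequal _ i.succ_ne_zero]
    simp [← Fin.coeSucc_eq_succ]

theorem four_mul_tan_mul_shoelace_le_pathLength_sq (hn : 2 < n) (z : Fin n → ℂ) :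
    4 * n * Real.tan (π / n) * shoelace z ≤ pathLength z ^ 2 := by
  obtain ⟨w, hlength, harea, hw⟩ := exists_equilateral (by omega) z
  have htan : 0 < Real.tan (π / n) := by
    refine Real.tan_pos_of_pos_of_lt_pi_div_two (by positivity) ?_
    gcongr
    exact_mod_cast hn
  have hequal : n * sqLength w = pathLength w ^ 2 := by
    simp only [sqLength, pathLength, hw, Finset.sum_const, Finset.card_univ, Fintype.card_fin,
      nsmul_eq_mul]
    ring
  calc 4 * n * Real.tan (π / n) * shoelace z
      ≤ 4 * n * Real.tan (π / n) * shoelace w := by gcongr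
    _ = n * (4 * Real.tan (π / n) * shoelace w) := by ring
    _ ≤ n * sqLength w := by gcongr; exact four_mul_tan_mul_shoelace_le hn w
    _ = pathLength w ^ 2 := hequal
    _ ≤ pathLength z ^ 2 := by gcongr; exact pathLength_nonneg w

theorem sum_edges_comp_neg (F : ℂ → ℂ → ℝ) (z : Fin n → ℂ) :
    ∑ i, F (z (-i)) (z (-(i + 1))) = ∑ i, F (z (i + 1)) (z i) := by
  refine Fintype.sum_equiv ((Equiv.addRight 1).trans (Equiv.neg _)) _ _ fun i => ?_
  simp

theorem four_mul_tan_mul_abs_shoelace_le_pathLength_sq (hn : 2 < n) (z : Fin n → ℂ) :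
    4 * n * Real.tan (π / n) * |shoelace z| ≤ pathLength z ^ 2 := by
  rcases abs_choice (shoelace z) with habs | habs <;> rw [habs]
  · exact four_mul_tan_mul_shoelace_le_pathLength_sq hn z
  have hlength : pathLength (fun i => z (-i)) = pathLength z := by
    simp only [pathLength, sum_edges_comp_neg dist, dist_comm]
  have harea : shoelace (fun i => z (-i)) = -shoelace z := by
    simp only [shoelace, sum_edges_comp_neg fun u v => (u.re * v.im - u.im * v.re) / 2,
      ← Finset.sum_neg_distrib]
    refine Finset.sum_congr rfl fun i _ => ?_
    ring
  rw [← hlength, ← harea]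
  exact four_mul_tan_mul_shoelace_le_pathLength_sq hn _

end ClosedPaths

/-! ### Areas of triangles -/

theorem cross_smul_add_smul (a b x y : ℂ) {s t : ℝ} (h : s + t = 1) :
    cross a b (s • x + t • y) = s * cross a b x + t * cross a b y := by
  obtain rfl : s = 1 - t := by linarith
  simp only [cross, Complex.add_re, Complex.add_im, Complex.real_smul, Complex.re_ofReal_mul,
    Complex.im_ofReal_mul]
  ring

theorem convex_setOf_cross_mem (a b : ℂ) {s : Set ℝ} (hs : Convex ℝ s) :
    Convex ℝ {x | cross a b x ∈ s} := by
  intro x hx y hy u v hu hv huv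
  rw [mem_ofPred_eq, cross_smul_add_smul a b x y huv]
  exact hs hx hy hu hv huv

theorem abs_cross_le (a b c : ℂ) : |cross a b c| ≤ dist a b * dist b c := by
  refine abs_le_of_sq_le_sq ?_ (by positivity)
  rw [mul_pow, dist_sq_eq, dist_sq_eq, cross]
  linarith [sq_nonneg ((b.re - a.re) * (c.re - b.re) + (b.im - a.im) * (c.im - b.im))]

theorem mem_convexHull_of_cross_nonneg {a b c x : ℂ} {s : ℝ} (h : 0 < s * cross a b c)
    (hab : 0 ≤ s * cross a b x) (hbc : 0 ≤ s * cross b c x) (hca : 0 ≤ s * cross c a x) :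
    x ∈ convexHull ℝ {a, b, c} := by
  set d := s * cross a b c with hd
  have hsum : s * cross b c x + s * cross c a x + s * cross a b x = d := by
    simp only [hd, cross]
    ring
  have hx : (s * cross b c x / d) • a + (s * cross c a x / d) • b + (s * cross a b x / d) • c
      = x := by
    apply Complex.ext <;>
    simp only [Complex.add_re, Complex.add_im, Complex.real_smul, Complex.re_ofReal_mul,
      Complex.im_ofReal_mul] <;> field_simp <;> simp only [hd, cross] <;> ring
  have := (convex_convexHull ℝ {a, b, c}).sum_mem (t := Finset.univ) (z := ![a, b, c])
    (w := ![s * cross b c x / d, s * cross c a x / d, s * cross a b x / d])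
    (by simpa [Fin.forall_fin_succ] using
      ⟨div_nonneg hbc h.le, div_nonneg hca h.le, div_nonneg hab h.le⟩)
    (by simp [Fin.sum_univ_three, ← add_div, hsum, h.ne'])
    (by simp [Fin.forall_fin_succ, subset_convexHull ℝ {a, b, c} _])
  rw [← hx]
  simpa [Fin.sum_univ_three] using this

theorem volume_setOf_nonneg_add_le_one_le :
    volume {p : ℝ × ℝ | 0 ≤ p.1 ∧ 0 ≤ p.2 ∧ p.1 + p.2 ≤ 1} ≤ ENNReal.ofReal (1 / 2) := by
  have hmeas : MeasurableSet {p : ℝ × ℝ | 0 ≤ p.1 ∧ 0 ≤ p.2 ∧ p.1 + p.2 ≤ 1} := by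
    measurability
  have hsection : ∀ x : ℝ, volume (Prod.mk x ⁻¹' {p : ℝ × ℝ | 0 ≤ p.1 ∧ 0 ≤ p.2 ∧ p.1 + p.2 ≤ 1}) ≤
      (Icc 0 1).indicator (fun x => ENNReal.ofReal (1 - x)) x := by
    intro x
    by_cases hx : x ∈ Icc (0 : ℝ) 1
    · rw [indicator_of_mem hx, ← sub_zero (1 - x), ← Real.volume_Icc]
      exact measure_mono fun y hy => ⟨hy.2.1, le_sub_iff_add_le'.2 hy.2.2⟩
    · refine (measure_mono_null (fun y hy => hx ⟨hy.1, ?_⟩) measure_empty).le.trans zero_le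
      exact (le_add_of_nonneg_right hy.2.1).trans hy.2.2
  have hint : ∫ x in Icc (0 : ℝ) 1, (1 - x) = 1 / 2 := by
    rw [integral_Icc_eq_integral_Ioc, ← intervalIntegral.integral_of_le zero_le_one]
    rw [intervalIntegral.integral_sub (by simp) (by simp)]
    norm_num [integral_id]
  rw [Measure.volume_eq_prod, Measure.prod_apply hmeas, ← hint,
    ofReal_integral_eq_lintegral_ofReal
      (by fun_prop : Continuous fun x : ℝ => 1 - x).integrableOn_Icc
      ((ae_restrict_mem measurableSet_Icc).mono fun x hx => sub_nonneg.2 hx.2),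
    ← lintegral_indicator measurableSet_Icc]
  exact lintegral_mono hsection

theorem volume_convexHull_zero_one_I_le :
    volume (convexHull ℝ {(0 : ℂ), 1, Complex.I}) ≤ ENNReal.ofReal (1 / 2) := by
  set S := {p : ℝ × ℝ | 0 ≤ p.1 ∧ 0 ≤ p.2 ∧ p.1 + p.2 ≤ 1}
  have hS : Convex ℝ S := by
    rintro x ⟨hx₁, hx₂, hx⟩ y ⟨hy₁, hy₂, hy⟩ s t hs ht hst
    refine ⟨?_, ?_, ?_⟩ <;>
      simp only [Prod.fst_add, Prod.snd_add, Prod.smul_fst, Prod.smul_snd, smul_eq_mul]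
    · positivity
    · positivity
    · nlinarith
  have hsub : convexHull ℝ {(0 : ℂ), 1, Complex.I} ⊆ Complex.measurableEquivRealProd ⁻¹' S := by
    refine convexHull_min ?_ (hS.linear_preimage Complex.equivRealProdLm.toLinearMap)
    rintro x (rfl | rfl | rfl) <;> simp [S, Complex.measurableEquivRealProd]
  calc _ ≤ volume (Complex.measurableEquivRealProd ⁻¹' S) := measure_mono hsub
    _ = volume S := Complex.volume_preserving_equiv_real_prod.measure_preimage_equiv S
    _ ≤ _ := volume_setOf_nonneg_add_le_one_le

theorem volume_convexHull_triple_le (a b c : ℂ) :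
    volume (convexHull ℝ {a, b, c}) ≤ ENNReal.ofReal (|cross a b c| / 2) := by
  set f : ℂ →ₗ[ℝ] ℂ := Complex.basisOneI.constr ℝ ![b - a, c - a] with hf
  have hf_one : f 1 = b - a := by simp [hf, Module.Basis.constr_apply_fintype]
  have hf_I : f Complex.I = c - a := by simp [hf, Module.Basis.constr_apply_fintype]
  have hdet : LinearMap.det f = cross a b c := by
    rw [← LinearMap.det_toMatrix Complex.basisOneI, Matrix.det_fin_two]
    simp [LinearMap.toMatrix_apply, hf_one, hf_I, cross]
    ring
  have himage : convexHull ℝ {a, b, c} =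
      (a + ·) '' (f '' convexHull ℝ {(0 : ℂ), 1, Complex.I}) := by
    have := convexHull_vadd (𝕜 := ℝ) a (f '' {0, 1, Complex.I})
    rw [← LinearMap.image_convexHull, ← image_vadd, ← image_vadd] at this
    simpa only [image_insert_eq, image_pair, image_singleton, map_zero, hf_one, hf_I, vadd_eq_add,
      add_zero, add_sub_cancel] using this
  rw [himage, image_add_left, measure_preimage_add, Measure.addHaar_image_linearMap, hdet,
    div_eq_mul_one_div, ENNReal.ofReal_mul (abs_nonneg _)]
  gcongr
  exact volume_convexHull_zero_one_I_le

theorem volume_convexHull_range_three_le (z : Fin 3 → ℂ) :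
    volume (convexHull ℝ (range z)) ≤ ENNReal.ofReal (pathLength z ^ 2 / (12 * √3)) := by
  have hrange : range z = {z 0, z 1, z 2} := by
    ext
    simp [Fin.exists_fin_succ, eq_comm]
  have hcross : cross (z 0) (z 1) (z 2) / 2 = shoelace z := by
    simp only [cross, shoelace, Fin.sum_univ_three, Fin.reduceAdd]
    ring
  have hlength := four_mul_tan_mul_abs_shoelace_le_pathLength_sq (by norm_num) z
  rw [Nat.cast_ofNat, Real.tan_pi_div_three] at hlength
  rw [hrange]
  refine (volume_convexHull_triple_le ..).trans (ENNReal.ofReal_le_ofReal ?_)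
  rw [le_div_iff₀ (by positivity), ← abs_two, ← abs_div, hcross]
  linarith

/-! ### Closed paths through four points -/

theorem succAbove_add_one {n : ℕ} (k : Fin (n + 2)) (i : Fin (n + 1)) : k.succAbove (i + 1) =
    if k.succAbove i + 1 = k then k + 1 else k.succAbove i + 1 := by
  have := i.isLt
  have := k.isLt
  simp only [Fin.ext_iff, Fin.succAbove, apply_ite Fin.val, Fin.val_add_one, Fin.lt_def,
    Fin.val_castSucc, Fin.val_succ, Fin.val_last]
  split_ifs <;> omega

theorem pathLength_comp_succAbove_le {n : ℕ} (z : Fin (n + 2) → ℂ) (k : Fin (n + 2)) :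
    pathLength (z ∘ k.succAbove) ≤ pathLength z := by
  calc pathLength (z ∘ k.succAbove)
      ≤ ∑ i, (dist (z (k.succAbove i)) (z (k.succAbove i + 1)) +
          if k.succAbove i + 1 = k then dist (z k) (z (k + 1)) else 0) := by
        refine Finset.sum_le_sum fun i _ => ?_
        simp only [Function.comp_apply, succAbove_add_one]
        split_ifs with h
        · rw [h]
          exact dist_triangle _ _ _
        · rw [add_zero]
    _ = ∑ i, dist (z (k.succAbove i)) (z (k.succAbove i + 1)) + dist (z k) (z (k + 1)) := by
        rw [Finset.sum_add_distrib]
        congr 1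
        have := Fin.sum_univ_succAbove
          (fun j => if j + 1 = k then dist (z k) (z (k + 1)) else 0) k
        simpa [← eq_sub_iff_add_eq] using this.symm
    _ = pathLength z := by rw [pathLength, Fin.sum_univ_succAbove _ k, add_comm]

theorem convexHull_range_comp_succAbove {n : ℕ} {z : Fin (n + 1) → ℂ} {k : Fin (n + 1)}
    (hk : z k ∈ convexHull ℝ (z '' {k}ᶜ)) :
    convexHull ℝ (range (z ∘ k.succAbove)) = convexHull ℝ (range z) := by
  rw [range_comp, Fin.range_succAbove]
  refine (convexHull_mono (image_subset_range _ _)).antisymm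
    (convexHull_min ?_ (convex_convexHull ℝ _))
  rintro _ ⟨i, rfl⟩
  rcases eq_or_ne i k with rfl | hi
  · exact hk
  · exact subset_convexHull _ _ ⟨i, hi, rfl⟩

theorem segment_subset_union {b d p : ℂ} (hp : p ∈ segment ℝ b d) :
    segment ℝ b d ⊆ segment ℝ b p ∪ segment ℝ p d := by
  intro x hx
  rw [segment_eq_image_lineMap] at hp
  rw [← insert_endpoints_openSegment] at hx
  rcases hx with rfl | rfl | hx
  · exact .inl (left_mem_segment ..)
  · exact .inr (right_mem_segment ..)
  rcases openSegment_subset_union _ _ (image_subset_range _ _ hp) hx with rfl | hx | hx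
  · exact .inl (right_mem_segment ..)
  · exact .inl (openSegment_subset_segment _ _ _ hx)
  · exact .inr (openSegment_subset_segment _ _ _ hx)

theorem convexHull_subset_union_of_mem_segment {a b c d p : ℂ} (hac : p ∈ segment ℝ a c)
    (hbd : p ∈ segment ℝ b d) :
    convexHull ℝ {a, b, c, d} ⊆ convexHull ℝ {a, b, c} ∪ convexHull ℝ {c, d, a} := by
  have hset : ({a, b, c, d} : Set ℂ) = {a, c, b, d} := by rw [insert_comm b c]
  rw [hset, ← convexJoin_segments]
  intro x hx
  obtain ⟨u, hu, v, hv, hx⟩ := mem_convexJoin.1 hx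
  have hmem {y : ℂ} {s : Set ℂ} (ha : a ∈ s) (hc : c ∈ s) (hy : y ∈ s)
      (hv : v ∈ segment ℝ p y) : x ∈ convexHull ℝ s := by
    have hconv := convex_convexHull ℝ s
    have hsub := subset_convexHull ℝ s
    exact hconv.segment_subset (hconv.segment_subset (hsub ha) (hsub hc) hu)
      (hconv.segment_subset (hconv.segment_subset (hsub ha) (hsub hc) hac) (hsub hy) hv) hx
  rcases segment_subset_union hbd hv with hv | hv
  · exact Or.inl (hmem (by simp) (by simp) (by simp) (segment_symm ℝ b p ▸ hv))
  · exact Or.inr (hmem (by simp) (by simp) (by simp) hv)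

theorem volume_convexHull_le_mul_add_mul {a b c d p : ℂ} (hac : p ∈ segment ℝ a c)
    (hbd : p ∈ segment ℝ b d) : volume (convexHull ℝ {a, b, c, d}) ≤
      ENNReal.ofReal ((dist a b * dist b c + dist c d * dist d a) / 2) := by
  calc volume (convexHull ℝ {a, b, c, d})
      ≤ volume (convexHull ℝ {a, b, c}) + volume (convexHull ℝ {c, d, a}) :=
        (measure_mono (convexHull_subset_union_of_mem_segment hac hbd)).trans (measure_union_le _ _)
    _ ≤ ENNReal.ofReal (|cross a b c| / 2) + ENNReal.ofReal (|cross c d a| / 2) :=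
        add_le_add (volume_convexHull_triple_le ..) (volume_convexHull_triple_le ..)
    _ ≤ _ := by
        rw [← ENNReal.ofReal_add (by positivity) (by positivity), ← add_div]
        gcongr <;> exact abs_cross_le ..

theorem volume_convexHull_le_of_mem_segment {a b c d p : ℂ} (hac : p ∈ segment ℝ a c)
    (hbd : p ∈ segment ℝ b d) : volume (convexHull ℝ {a, b, c, d}) ≤
      ENNReal.ofReal ((dist a b + dist b c + dist c d + dist d a) ^ 2 / 16) := by
  have hset : ({b, c, d, a} : Set ℂ) = {a, b, c, d} := by
    ext
    simp only [mem_insert_iff, mem_singleton_iff]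
    tauto
  have h₁ := volume_convexHull_le_mul_add_mul hac hbd
  have h₂ := volume_convexHull_le_mul_add_mul hbd (segment_symm ℝ a c ▸ hac)
  rw [hset] at h₂
  -- The two bounds add up to `(ab + cd) (bc + da) / 2`, so AM-GM applies to the smaller one.
  have hsq := sq_nonneg ((dist a b + dist c d) - (dist b c + dist d a))
  rcases le_total (dist a b * dist b c + dist c d * dist d a)
    (dist b c * dist c d + dist d a * dist a b) with h | h
  · refine h₁.trans (ENNReal.ofReal_le_ofReal ?_)
    linarith
  · refine h₂.trans (ENNReal.ofReal_le_ofReal ?_)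
    linarith

theorem dist_add_dist_le_of_mem_segment {a b c d p : ℂ} (hab : p ∈ segment ℝ a b)
    (hcd : p ∈ segment ℝ c d) : dist a c + dist b d ≤ dist a b + dist c d := by
  linarith [dist_add_dist_of_mem_segment hab, dist_add_dist_of_mem_segment hcd,
    dist_triangle a p c, dist_triangle b p d, dist_comm p b, dist_comm c p]

theorem exists_segment_inter_segment {z : Fin 4 → ℂ} (hz : ConvexIndependent ℝ z) :
    (segment ℝ (z 0) (z 1) ∩ segment ℝ (z 2) (z 3)).Nonempty ∨
      (segment ℝ (z 0) (z 2) ∩ segment ℝ (z 1) (z 3)).Nonempty ∨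
      (segment ℝ (z 0) (z 3) ∩ segment ℝ (z 1) (z 2)).Nonempty := by
  have hdep : ¬ AffineIndependent ℝ z := by
    intro h
    have hcard := h.card_le_finrank_succ
    have hrank := (vectorSpan ℝ (range z)).finrank_le
    rw [Complex.finrank_real_complex] at hrank
    simp only [Fintype.card_fin] at hcard
    omega
  obtain ⟨I, p, hpI, hpIc⟩ := Convex.radon_partition hdep
  lift I to Finset (Fin 4) using I.toFinite
  rw [← Finset.coe_compl] at hpIc
  wlog hI : 0 ∈ I generalizing I
  · exact this Iᶜ hpIc (by rwa [compl_compl]) (Finset.mem_compl.2 hI)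
  have hsingleton {J : Finset (Fin 4)} {i : Fin 4} (hJ : p ∈ convexHull ℝ (z '' ↑J)) (hi : J = {i})
      (hJc : p ∈ convexHull ℝ (z '' ↑Jᶜ)) : False := by
    subst hi
    rw [Finset.coe_singleton, image_singleton, convexHull_singleton, mem_singleton_iff] at hJ
    have hi := hz _ i (hJ ▸ hJc)
    simp at hi
  have hpair : ∀ {i j : Fin 4} {J : Finset (Fin 4)}, p ∈ convexHull ℝ (z '' ↑J) → J = {i, j} →
      p ∈ segment ℝ (z i) (z j) := by
    rintro i j _ hp rfl
    rwa [Finset.coe_pair, image_pair, convexHull_pair] at hp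
  have hcases : ∀ I : Finset (Fin 4), 0 ∈ I → Iᶜ = ∅ ∨ (∃ i, I = {i}) ∨ (∃ i, Iᶜ = {i}) ∨
      (I = {0, 1} ∧ Iᶜ = {2, 3}) ∨ (I = {0, 2} ∧ Iᶜ = {1, 3}) ∨ (I = {0, 3} ∧ Iᶜ = {1, 2}) := by
    decide
  rcases hcases I hI with h | ⟨i, hi⟩ | ⟨i, hi⟩ | ⟨h, h'⟩ | ⟨h, h'⟩ | ⟨h, h'⟩
  · simp [h] at hpIc
  · exact (hsingleton hpI hi hpIc).elim
  · exact (hsingleton hpIc hi (by rwa [compl_compl])).elim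
  · exact Or.inl ⟨p, hpair hpI h, hpair hpIc h'⟩
  · exact Or.inr (Or.inl ⟨p, hpair hpI h, hpair hpIc h'⟩)
  · exact Or.inr (Or.inr ⟨p, hpair hpI h, hpair hpIc h'⟩)

theorem convexIndependent_iff_notMem_convexHull_image_compl {ι : Type*} {z : ι → ℂ} :
    ConvexIndependent ℝ z ↔ ∀ k, z k ∉ convexHull ℝ (z '' {k}ᶜ) := by
  rw [convexIndependent_iff_notMem_convexHull_sdiff]
  refine ⟨fun h k => ?_, fun h k s hk => h k (convexHull_mono (image_mono ?_) hk)⟩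
  · rw [compl_eq_univ_sdiff]
    exact h k univ
  · exact fun _ hx => hx.2

theorem volume_convexHull_range_four_le (z : Fin 4 → ℂ) :
    volume (convexHull ℝ (range z)) ≤ ENNReal.ofReal (pathLength z ^ 2 / 16) := by
  by_cases hz : ConvexIndependent ℝ z
  · have hrange : range z = {z 0, z 1, z 2, z 3} := by
      ext
      simp [Fin.exists_fin_succ, eq_comm]
    have hlength : pathLength z =
        dist (z 0) (z 1) + dist (z 1) (z 2) + dist (z 2) (z 3) + dist (z 3) (z 0) := by
      simp only [pathLength, Fin.sum_univ_four, Fin.reduceAdd]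
    rw [hrange, hlength]
    rcases exists_segment_inter_segment hz with ⟨p, hp, hq⟩ | ⟨p, hp, hq⟩ | ⟨p, hp, hq⟩
    · rw [insert_comm (z 1)]
      refine (volume_convexHull_le_of_mem_segment hp hq).trans (ENNReal.ofReal_le_ofReal ?_)
      gcongr ?_ ^ 2 / 16
      linarith [dist_add_dist_le_of_mem_segment hp hq, dist_comm (z 1) (z 2)]
    · exact volume_convexHull_le_of_mem_segment hp hq
    · rw [pair_comm (z 2)]
      refine (volume_convexHull_le_of_mem_segment hp hq).trans (ENNReal.ofReal_le_ofReal ?_)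
      gcongr ?_ ^ 2 / 16
      linarith [dist_add_dist_le_of_mem_segment hp (segment_symm ℝ (z 1) (z 2) ▸ hq),
        dist_comm (z 2) (z 0), dist_comm (z 3) (z 1), dist_comm (z 3) (z 2), dist_comm (z 3) (z 0),
        dist_comm (z 2) (z 1)]
  · rw [convexIndependent_iff_notMem_convexHull_image_compl] at hz
    push Not at hz
    obtain ⟨k, hk⟩ := hz
    rw [← convexHull_range_comp_succAbove hk]
    refine (volume_convexHull_range_three_le _).trans (ENNReal.ofReal_le_ofReal ?_)
    have hsqrt : 4 / 3 ≤ √3 := Real.le_sqrt_of_sq_le (by norm_num)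
    gcongr
    · exact pathLength_nonneg _
    · exact pathLength_comp_succAbove_le z k
    · linarith

/-! ### Closed paths through five points -/

theorem volume_convexHull_range_five_le_of_mem {z : Fin 5 → ℂ} {k : Fin 5}
    (hk : z k ∈ convexHull ℝ (z '' {k}ᶜ)) :
    volume (convexHull ℝ (range z)) ≤ ENNReal.ofReal (pathLength z ^ 2 / 16) := by
  rw [← convexHull_range_comp_succAbove hk]
  refine (volume_convexHull_range_four_le _).trans (ENNReal.ofReal_le_ofReal ?_)
  gcongr
  · exact pathLength_nonneg _
  · exact pathLength_comp_succAbove_le z k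

theorem convexHull_image_compl_of_forall_mem {ι : Type*} [Finite ι] {z : ι → ℂ}
    (hz : Function.Injective z) {s : Set ι} (hs : ∀ k ∈ s, z k ∈ convexHull ℝ (z '' {k}ᶜ)) :
    convexHull ℝ (z '' sᶜ) = convexHull ℝ (range z) := by
  have hextreme : (convexHull ℝ (range z)).extremePoints ℝ ⊆ z '' sᶜ := by
    intro x hx
    obtain ⟨k, rfl⟩ := extremePoints_convexHull_subset hx
    refine ⟨k, fun hk => ?_, rfl⟩
    rw [(convex_convexHull ℝ _).mem_extremePoints_iff_mem_sdiff_convexHull_sdiff] at hx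
    refine hx.2 (convexHull_mono ?_ (hs k hk))
    rintro _ ⟨l, hl, rfl⟩
    exact ⟨subset_convexHull ℝ _ (mem_range_self l), hz.ne hl⟩
  refine (convexHull_mono (image_subset_range _ _)).antisymm ?_
  rw [← closure_convexHull_extremePoints ((finite_range z).isCompact_convexHull ℝ)
    (convex_convexHull ℝ _)]
  exact closure_minimal (convexHull_mono hextreme) (((toFinite _).image z).isClosed_convexHull ℝ)

theorem volume_convexHull_range_five_le_of_mem_of_mem {z : Fin 5 → ℂ} (hz : Function.Injective z)
    {i j : Fin 5} (hij : i ≠ j) (hi : z i ∈ convexHull ℝ (z '' {i}ᶜ))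
    (hj : z j ∈ convexHull ℝ (z '' {j}ᶜ)) :
    volume (convexHull ℝ (range z)) ≤ ENNReal.ofReal (pathLength z ^ 2 / (12 * √3)) := by
  obtain ⟨l, rfl⟩ := Fin.exists_succAbove_eq hij.symm
  have himage : (z ∘ i.succAbove) '' {l}ᶜ = z '' {i, i.succAbove l}ᶜ := by
    rw [image_comp, image_compl_eq_range_sdiff_image Fin.succAbove_right_injective,
      Fin.range_succAbove, image_singleton, insert_eq, compl_union, sdiff_eq]
  have hl : (z ∘ i.succAbove) l ∈ convexHull ℝ ((z ∘ i.succAbove) '' {l}ᶜ) := by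
    rw [himage, convexHull_image_compl_of_forall_mem hz (by simp [hi, hj])]
    exact subset_convexHull _ _ (mem_range_self _)
  rw [← convexHull_range_comp_succAbove hi, ← convexHull_range_comp_succAbove hl]
  refine (volume_convexHull_range_three_le _).trans (ENNReal.ofReal_le_ofReal ?_)
  gcongr
  · exact pathLength_nonneg _
  · exact (pathLength_comp_succAbove_le _ l).trans (pathLength_comp_succAbove_le z i)

theorem mem_segment_of_cross_eq_zero {a b c : ℂ} (h : cross a b c = 0) :
    a ∈ segment ℝ b c ∨ b ∈ segment ℝ c a ∨ c ∈ segment ℝ a b := by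
  have hcol : Collinear ℝ {a, b, c} := by
    rcases eq_or_ne a b with rfl | hab
    · simpa using collinear_pair ℝ a c
    rw [collinear_iff_of_mem (p₀ := a) (by simp)]
    refine ⟨b - a, ?_⟩
    simp only [mem_insert_iff, mem_singleton_iff, forall_eq_or_imp, forall_eq]
    refine ⟨⟨0, by simp⟩, ⟨1, by simp⟩, ((c - a) / (b - a)).re, ?_⟩
    have him : ((c - a) / (b - a)).im = 0 := by
      rw [Complex.div_im, ← sub_div, div_eq_zero_iff]
      left
      simp only [Complex.sub_re, Complex.sub_im]
      rw [cross] at h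
      linear_combination h
    have hreal : ((((c - a) / (b - a)).re : ℝ) : ℂ) = (c - a) / (b - a) :=
      Complex.ext rfl (by simp [him])
    rw [Complex.real_smul, hreal, div_mul_cancel₀ _ (sub_ne_zero.2 hab.symm), vadd_eq_add,
      sub_add_cancel]
  rcases hcol.wbtw_or_wbtw_or_wbtw with h | h | h
  · exact Or.inr (Or.inl (segment_symm ℝ a c ▸ h.mem_segment))
  · exact Or.inr (Or.inr (segment_symm ℝ b a ▸ h.mem_segment))
  · exact Or.inl (segment_symm ℝ c b ▸ h.mem_segment)

theorem cross_mul_cross_pos {ι : Type*} {z : ι → ℂ} (hz : ConvexIndependent ℝ z) {i j k l : ι}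
    (hi : i ∉ ({j, k, l} : Set ι)) (hj : j ∉ ({i, k, l} : Set ι))
    (hdisj : Disjoint (segment ℝ (z i) (z j)) (segment ℝ (z k) (z l))) :
    0 < cross (z i) (z j) (z k) * cross (z i) (z j) (z l) := by
  by_contra! hle
  obtain ⟨p, hp, hcross⟩ : ∃ p ∈ segment ℝ (z k) (z l), cross (z i) (z j) p = 0 := by
    have hzero : (0 : ℝ) ∈ segment ℝ (cross (z i) (z j) (z k)) (cross (z i) (z j) (z l)) := by
      rw [segment_eq_uIcc, mem_uIcc]
      rcases mul_nonpos_iff.1 hle with h | h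
      · exact Or.inr h.symm
      · exact Or.inl h
    obtain ⟨s, t, hs, ht, hst, h⟩ := hzero
    exact ⟨s • z k + t • z l, ⟨s, t, hs, ht, hst, rfl⟩, (cross_smul_add_smul _ _ _ _ hst).trans h⟩
  have hmem {a b : ι} (ha : z a ∈ segment ℝ (z b) p) : a ∈ ({b, k, l} : Set ι) := by
    refine hz _ a ((convex_convexHull ℝ _).segment_subset ?_ ?_ ha)
    · exact subset_convexHull _ _ (by simp)
    · exact segment_subset_convexHull (by simp) (by simp) hp
  rcases mem_segment_of_cross_eq_zero hcross with h | h | h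
  · exact hi (hmem h)
  · exact hj (hmem (segment_symm ℝ p (z i) ▸ h))
  · exact disjoint_left.1 hdisj h hp

theorem exists_sign_of_convexIndependent {z : Fin 5 → ℂ} (hz : ConvexIndependent ℝ z)
    (hdisj : ∀ i, Disjoint (segment ℝ (z i) (z (i + 1))) (segment ℝ (z (i + 2)) (z (i + 3)))) :
    ∃ s : ℝ, |s| = 1 ∧ ∀ i j, j ≠ i → j ≠ i + 1 → 0 < s * cross (z i) (z (i + 1)) (z j) := by
  have h₂₃ (i) : 0 < cross (z i) (z (i + 1)) (z (i + 2)) * cross (z i) (z (i + 1)) (z (i + 3)) :=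
    cross_mul_cross_pos hz (by revert i; decide) (by revert i; decide) (hdisj i)
  have h₃₄ (i) : 0 < cross (z i) (z (i + 1)) (z (i + 3)) * cross (z i) (z (i + 1)) (z (i + 4)) := by
    refine cross_mul_cross_pos hz (by revert i; decide) (by revert i; decide) ?_
    simpa [add_assoc] using (hdisj (i + 3)).symm
  have hcyclic (i) : cross (z (i + 1)) (z (i + 1 + 1)) (z (i + 1 + 4)) =
      cross (z i) (z (i + 1)) (z (i + 2)) := by
    simp only [add_assoc, Fin.reduceAdd, add_zero, cross]
    ring
  set c := cross (z 0) (z 1) (z 2)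
  have hc : c ≠ 0 := left_ne_zero_of_mul (h₂₃ 0).ne'
  have hsign {x y : ℝ} (hx : 0 < c / |c| * x) (hxy : 0 < x * y) : 0 < c / |c| * y := by
    have : 0 < c / |c| * y * x ^ 2 := by linarith [mul_pos hx hxy]
    exact pos_of_mul_pos_left this (sq_nonneg x)
  have hturn (i : Fin 5) : 0 < c / |c| * cross (z i) (z (i + 1)) (z (i + 2)) := by
    induction i using Fin.induction with
    | zero =>
      change 0 < c / |c| * c
      rw [div_mul_eq_mul_div]
      exact div_pos (mul_self_pos.2 hc) (abs_pos.2 hc)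
    | succ i ih =>
      rw [← Fin.coeSucc_eq_succ]
      rw [← hcyclic] at ih
      exact hsign (hsign ih (mul_comm _ (cross _ _ (z (_ + 3))) ▸ h₃₄ _))
        (mul_comm _ (cross _ _ (z (_ + 2))) ▸ h₂₃ _)
  refine ⟨c / |c|, by rw [abs_div, abs_abs, div_self (abs_ne_zero.2 hc)], fun i j hj hj' => ?_⟩
  have hcases : ∀ i j : Fin 5, j ≠ i → j ≠ i + 1 → j = i + 2 ∨ j = i + 3 ∨ j = i + 4 := by decide
  rcases hcases i j hj hj' with rfl | rfl | rfl
  · exact hturn i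
  · exact hsign (hturn i) (h₂₃ i)
  · exact hsign (hsign (hturn i) (h₂₃ i)) (h₃₄ i)

theorem convexHull_range_five_subset {z : Fin 5 → ℂ} {s : ℝ}
    (hz : ∀ i j, j ≠ i → j ≠ i + 1 → 0 < s * cross (z i) (z (i + 1)) (z j)) :
    convexHull ℝ (range z) ⊆ convexHull ℝ {z 0, z 1, z 2} ∪
      convexHull ℝ {z 2, z 3, z 0} ∪ convexHull ℝ {z 3, z 4, z 0} := by
  have hedge {p} (hp : p ∈ convexHull ℝ (range z)) (i) : 0 ≤ s * cross (z i) (z (i + 1)) p := by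
    refine convexHull_min (t := {p | cross (z i) (z (i + 1)) p ∈ {x | 0 ≤ s * x}}) ?_
      (convex_setOf_cross_mem _ _ ?_) hp
    · rintro _ ⟨j, rfl⟩
      rcases eq_or_ne j i with rfl | hj
      · simp [cross]
      rcases eq_or_ne j (i + 1) with rfl | hj'
      · simp [cross, mul_comm]
      · exact (hz i j hj hj').le
    · exact (convex_Ici 0).linear_preimage (LinearMap.mulLeft ℝ s)
  have h₀₁₂ : 0 < s * cross (z 0) (z 1) (z 2) := hz 0 2 (by decide) (by decide)
  have h₂₃₀ : 0 < s * cross (z 2) (z 3) (z 0) := hz 2 0 (by decide) (by decide)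
  have h₃₄₀ : 0 < s * cross (z 3) (z 4) (z 0) := hz 3 0 (by decide) (by decide)
  intro p hp
  have hswap (u v : ℂ) : s * cross u v p = -(s * cross v u p) := by simp only [cross]; ring
  rcases le_total 0 (s * cross (z 2) (z 0) p) with h₂₀ | h₀₂
  · exact Or.inl (Or.inl (mem_convexHull_of_cross_nonneg h₀₁₂ (hedge hp 0) (hedge hp 1) h₂₀))
  rcases le_total 0 (s * cross (z 3) (z 0) p) with h₃₀ | h₀₃
  · refine Or.inl (Or.inr (mem_convexHull_of_cross_nonneg h₂₃₀ (hedge hp 2) h₃₀ ?_))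
    linarith [hswap (z 0) (z 2)]
  · refine Or.inr (mem_convexHull_of_cross_nonneg h₃₄₀ (hedge hp 3) (hedge hp 4) ?_)
    linarith [hswap (z 0) (z 3)]

theorem volume_convexHull_range_five_le_abs_shoelace {z : Fin 5 → ℂ} {s : ℝ} (hs : |s| = 1)
    (hz : ∀ i j, j ≠ i → j ≠ i + 1 → 0 < s * cross (z i) (z (i + 1)) (z j)) :
    volume (convexHull ℝ (range z)) ≤ ENNReal.ofReal |shoelace z| := by
  have h₀₁₂ : 0 < s * cross (z 0) (z 1) (z 2) := hz 0 2 (by decide) (by decide)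
  have h₂₃₀ : 0 < s * cross (z 2) (z 3) (z 0) := hz 2 0 (by decide) (by decide)
  have h₃₄₀ : 0 < s * cross (z 3) (z 4) (z 0) := hz 3 0 (by decide) (by decide)
  have habs {x : ℝ} (hx : 0 < s * x) : |x| = s * x := by
    rw [← abs_of_pos hx, abs_mul, hs, one_mul]
  have hshoelace : cross (z 0) (z 1) (z 2) / 2 + cross (z 2) (z 3) (z 0) / 2 +
      cross (z 3) (z 4) (z 0) / 2 = shoelace z := by
    simp only [shoelace, cross, Fin.sum_univ_five, Fin.reduceAdd]
    ring
  calc volume (convexHull ℝ (range z))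
      ≤ volume (convexHull ℝ {z 0, z 1, z 2}) + volume (convexHull ℝ {z 2, z 3, z 0}) +
          volume (convexHull ℝ {z 3, z 4, z 0}) :=
        (measure_mono (convexHull_range_five_subset hz)).trans
          ((measure_union_le _ _).trans (add_le_add_left (measure_union_le _ _) _))
    _ ≤ ENNReal.ofReal (|cross (z 0) (z 1) (z 2)| / 2) +
          ENNReal.ofReal (|cross (z 2) (z 3) (z 0)| / 2) +
          ENNReal.ofReal (|cross (z 3) (z 4) (z 0)| / 2) := by
        gcongr <;> exact volume_convexHull_triple_le ..
    _ = ENNReal.ofReal (s * shoelace z) := by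
        rw [← ENNReal.ofReal_add (by positivity) (by positivity),
          ← ENNReal.ofReal_add (by positivity) (by positivity), habs h₀₁₂, habs h₂₃₀, habs h₃₄₀,
          ← hshoelace]
        congr 1
        ring
    _ ≤ ENNReal.ofReal |shoelace z| := by
        gcongr
        simpa [abs_mul, hs] using le_abs_self (s * shoelace z)

theorem volume_convexHull_range_five_le_of_convexIndependent {z : Fin 5 → ℂ}
    (hz : ConvexIndependent ℝ z)
    (hdisj : ∀ i, Disjoint (segment ℝ (z i) (z (i + 1))) (segment ℝ (z (i + 2)) (z (i + 3)))) :
    volume (convexHull ℝ (range z)) ≤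
      ENNReal.ofReal (pathLength z ^ 2 / (20 * Real.tan (π / 5))) := by
  obtain ⟨s, hs, hsign⟩ := exists_sign_of_convexIndependent hz hdisj
  refine (volume_convexHull_range_five_le_abs_shoelace hs hsign).trans
    (ENNReal.ofReal_le_ofReal ?_)
  have htan : 0 < Real.tan (π / 5) :=
    Real.tan_pos_of_pos_of_lt_pi_div_two (by positivity) (by linarith [Real.pi_pos])
  have hlength := four_mul_tan_mul_abs_shoelace_le_pathLength_sq (by norm_num) z
  rw [le_div_iff₀ (by positivity)]
  push_cast at hlength
  linarith

/-! ### Pentagons and the convex hull of their vertices -/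

theorem subset_of_frontier_subset {E : Type*} [NormedAddCommGroup E] [NormedSpace ℝ E]
    {K C : Set E} (hK : IsCompact K) (hC : IsClosed C) (hconvex : Convex ℝ C) (hne : C.Nonempty)
    (h : frontier K ⊆ C) : K ⊆ C := by
  intro x hx
  by_contra hxC
  obtain ⟨f, u, hf, hfx⟩ := geometric_hahn_banach_closed_point hconvex hC hxC
  obtain ⟨y, hyK, hy⟩ := hK.exists_isMaxOn ⟨x, hx⟩ f.continuous.continuousOn
  have hfy : f x ≤ f y := hy hx
  have hyint : y ∈ interior K := by
    by_contra hyint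
    linarith [hf y (h ⟨subset_closure hyK, hyint⟩)]
  have hf0 : f = 0 :=
    (hy.isLocalMax (mem_interior_iff_mem_nhds.1 hyint)).hasFDerivAt_eq_zero f.hasFDerivAt
  obtain ⟨a, ha⟩ := hne
  have hfa := hf a ha
  simp only [hf0, zero_apply] at hfa hfx
  exact lt_asymm hfa hfx

theorem edgeSet_eq_segment {n : ℕ} (P : Polygon ℂ n) (i : Fin n) :
    P.edgeSet ℝ i = segment ℝ (P i) (P (finRotate n i)) :=
  affineSegment_eq_segment _ _ _

theorem boundary_eq_iUnion_segment {n : ℕ} (P : Polygon ℂ n) :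
    P.boundary ℝ = ⋃ i, segment ℝ (P i) (P (finRotate n i)) := by
  simp only [Polygon.boundary, edgeSet_eq_segment]

theorem perimeter_eq_pathLength {n : ℕ} [NeZero n] (P : Polygon ℂ n) :
    perimeter P = pathLength P.vertices := by
  obtain ⟨m, rfl⟩ := Nat.exists_eq_succ_of_ne_zero (NeZero.ne n)
  simp only [perimeter, pathLength, finRotate_apply]

namespace Pentagon

theorem region_subset_convexHull (P : Pentagon) :
    P.region ⊆ convexHull ℝ (range P.poly.vertices) := by
  refine subset_of_frontier_subset P.isCompact_region ((finite_range _).isClosed_convexHull ℝ)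
    (convex_convexHull ℝ _) (convexHull_nonempty_iff.2 (range_nonempty _)) ?_
  rw [P.frontier_region, boundary_eq_iUnion_segment]
  exact iUnion_subset fun i => segment_subset_convexHull (mem_range_self _) (mem_range_self _)

theorem disjoint_segment (P : Pentagon) (i : Fin 5) :
    Disjoint (segment ℝ (P.poly i) (P.poly (i + 1)))
      (segment ℝ (P.poly (i + 2)) (P.poly (i + 3))) := by
  have hsimple := P.simple i (i + 2) (by simp)
  simp only [edgeSet_eq_segment, finRotate_apply, add_assoc, Fin.reduceAdd] at hsimple
  refine disjoint_left.2 fun p hp hp' => ?_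
  obtain ⟨h, h'⟩ := hsimple ⟨hp, hp'⟩
  have hne : ∀ i : Fin 5, i ≠ i + 2 ∧ i ≠ i + 3 ∧ i + 1 ≠ i + 2 ∧ i + 1 ≠ i + 3 := by decide
  obtain ⟨h₂, h₃, h₁₂, h₁₃⟩ := hne i
  rcases h with rfl | rfl <;> rcases h' with h' | h'
  · exact h₂ (P.vertices_injective h')
  · exact h₃ (P.vertices_injective h')
  · exact h₁₂ (P.vertices_injective h')
  · exact h₁₃ (P.vertices_injective h')

end Pentagon

theorem inner_exp_mul_I (c : ℂ) (φ : ℝ) :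
    inner ℝ c (Complex.exp (φ * Complex.I)) = ‖c‖ * Real.cos (φ - c.arg) := by
  rw [Complex.inner, Complex.mul_re, Complex.conj_re, Complex.conj_im,
    Complex.exp_ofReal_mul_I_re, Complex.exp_ofReal_mul_I_im, Real.cos_sub]
  linear_combination -Real.cos φ * Complex.norm_mul_cos_arg c -
    Real.sin φ * Complex.norm_mul_sin_arg c

theorem volume_setOf_inner_exp_nonneg_le {c : ℂ} (hc : c ≠ 0) :
    volume {φ : ℝ | φ ∈ Ioc (-π) π ∧ 0 ≤ inner ℝ c (Complex.exp (φ * Complex.I))} ≤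
      ENNReal.ofReal π := by
  set A : Set ℝ := {φ | 0 ≤ Real.cos (φ - c.arg)}
  have hA : MeasurableSet A :=
    (isClosed_le continuous_const (by fun_prop)).measurableSet
  have hperiod (g : AddSubgroup.zmultiples (2 * π)) : (fun x => g +ᵥ x) ⁻¹' A = A := by
    obtain ⟨_, n, rfl⟩ := g
    ext φ
    simp [A, AddSubgroup.vadd_def, add_sub_assoc, add_comm _ (φ - _),
      Real.cos_add_int_mul_two_pi]
  have hsub : A ∩ Ioc (c.arg - π) (c.arg - π + 2 * π) ⊆
      Icc (c.arg - π / 2) (c.arg + π / 2) := by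
    rintro φ ⟨hφ : 0 ≤ Real.cos (φ - c.arg), h₁, h₂⟩
    refine ⟨?_, ?_⟩ <;> by_contra! h <;> refine not_lt.2 hφ ?_
    · rw [← Real.cos_neg]
      exact Real.cos_neg_of_pi_div_two_lt_of_lt (by linarith) (by linarith [Real.pi_pos])
    · exact Real.cos_neg_of_pi_div_two_lt_of_lt (by linarith) (by linarith [Real.pi_pos])
  calc volume {φ : ℝ | φ ∈ Ioc (-π) π ∧ 0 ≤ inner ℝ c (Complex.exp (φ * Complex.I))}
      = volume (A ∩ Ioc (-π) (-π + 2 * π)) := by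
        congr 1
        ext φ
        rw [mem_ofPred_eq, inner_exp_mul_I, mul_nonneg_iff_of_pos_left (norm_pos_iff.2 hc),
          and_comm, two_mul, neg_add_cancel_left]
        rfl
    _ = volume (A ∩ Ioc (c.arg - π) (c.arg - π + 2 * π)) :=
        (isAddFundamentalDomain_Ioc Real.two_pi_pos _).measure_set_eq
          (isAddFundamentalDomain_Ioc Real.two_pi_pos _) hA hperiod
    _ ≤ volume (Icc (c.arg - π / 2) (c.arg + π / 2)) := measure_mono hsub
    _ = ENNReal.ofReal π := by
        rw [Real.volume_Icc]
        ring_nf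

namespace Pentagon

theorem interiorAngle_le_pi {P : Pentagon} {k : Fin 5} {c : ℂ} (hc : c ≠ 0)
    (h : ∀ x ∈ P.region, inner ℝ c (P.poly k) ≤ inner ℝ c x) : P.interiorAngle k ≤ π := by
  refine ENNReal.toReal_le_of_le_ofReal Real.pi_pos.le
    ((measure_mono ?_).trans (volume_setOf_inner_exp_nonneg_le hc))
  rintro φ ⟨hφ, hregion⟩
  obtain ⟨r, hr, hr0⟩ := (hregion.and (self_mem_nhdsWithin (s := Ioi (0 : ℝ)))).exists
  have hle := h _ hr
  rw [inner_add_right, le_add_iff_nonneg_right, ← Complex.real_smul, real_inner_smul_right,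
    mul_nonneg_iff_of_pos_left hr0] at hle
  exact ⟨hφ, hle⟩

/-- The vertices with a reflex interior angle. -/
def reflexVertices (P : Pentagon) : Set (Fin 5) :=
  {k | π < P.interiorAngle k}

theorem mem_convexHull_of_mem_reflexVertices {P : Pentagon} {k : Fin 5}
    (hk : k ∈ P.reflexVertices) : P.poly k ∈ convexHull ℝ (P.poly.vertices '' {k}ᶜ) := by
  by_contra hhull
  obtain ⟨f, u, hfk, hf⟩ := geometric_hahn_banach_point_closed (convex_convexHull ℝ _)
    (((toFinite {k}ᶜ).image P.poly.vertices).isClosed_convexHull ℝ) hhull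
  have hother {j} (hj : j ≠ k) : f (P.poly k) < f (P.poly j) :=
    hfk.trans (hf _ (subset_convexHull ℝ _ ⟨j, hj, rfl⟩))
  have hregion : ∀ x ∈ P.region, f (P.poly k) ≤ f x := by
    intro x hx
    refine convexHull_min (t := {x | f (P.poly k) ≤ f x}) ?_
      (convex_halfSpace_ge f.toLinearMap.isLinear _) (P.region_subset_convexHull hx)
    rintro _ ⟨j, rfl⟩
    rcases eq_or_ne j k with rfl | hj
    · exact le_refl (f (P.poly j))
    · exact (hother hj).le
  obtain ⟨c, rfl⟩ := (InnerProductSpace.toDual ℝ ℂ).surjective f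
  have hc : c ≠ 0 := by
    rintro rfl
    simpa using hother (j := k + 1) (by simp)
  exact not_le.2 hk (interiorAngle_le_pi hc hregion)

/-! ### Lower bounds for the perimeter of a pentagon of unit area -/

theorem le_perimeter_of_volume_convexHull_le {P : Pentagon} (hP : volume P.region = 1) {c l : ℝ}
    (hc : 0 < c) (hl : l ^ 2 ≤ c)
    (h : volume (convexHull ℝ (range P.poly.vertices)) ≤
      ENNReal.ofReal (pathLength P.poly.vertices ^ 2 / c)) : l ≤ perimeter P.poly := by
  have hone := (measure_mono P.region_subset_convexHull).trans h
  rw [hP, ENNReal.one_le_ofReal, le_div_iff₀ hc, one_mul, ← perimeter_eq_pathLength] at hone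
  exact le_of_sq_le_sq (hl.trans hone) (Finset.sum_nonneg fun _ _ => dist_nonneg)

theorem four_le_perimeter {P : Pentagon} (hP : volume P.region = 1) {k : Fin 5}
    (hk : P.poly k ∈ convexHull ℝ (P.poly.vertices '' {k}ᶜ)) : 4 ≤ perimeter P.poly :=
  le_perimeter_of_volume_convexHull_le hP (by norm_num) (by norm_num)
    (volume_convexHull_range_five_le_of_mem hk)

end Pentagon

theorem lt_tan_pi_div_five : 0.7265 < Real.tan (π / 5) := by
  have hsqrt : √5 ^ 2 = 5 := Real.sq_sqrt (by norm_num)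
  have hcos := Real.cos_pi_div_five
  have hcos0 : Real.cos (π / 5) ≠ 0 := by
    rw [hcos]
    positivity
  have htan : Real.tan (π / 5) ^ 2 = 5 - 2 * √5 := by
    have hinv := Real.inv_one_add_tan_sq hcos0
    rw [hcos, inv_eq_iff_eq_inv] at hinv
    rw [eq_sub_of_add_eq' hinv]
    field_simp
    linear_combination (2 * √5 - 2) * hsqrt
  have hpos : 0 < Real.tan (π / 5) :=
    Real.tan_pos_of_pos_of_lt_pi_div_two (by positivity) (by linarith [Real.pi_pos])
  have hlt : √5 < 2.23607 := (Real.sqrt_lt' (by norm_num)).2 (by norm_num)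
  refine lt_of_pow_lt_pow_left₀ 2 hpos.le ?_
  rw [htan]
  norm_num
  linarith

namespace Pentagon

theorem le_perimeter {P : Pentagon} (hP : volume P.region = 1) : 3.81182 ≤ perimeter P.poly := by
  by_cases h : ConvexIndependent ℝ P.poly.vertices
  · refine le_perimeter_of_volume_convexHull_le hP ?_ ?_
      (volume_convexHull_range_five_le_of_convexIndependent h P.disjoint_segment)
    · linarith [lt_tan_pi_div_five]
    · norm_num
      linarith [lt_tan_pi_div_five]
  · rw [convexIndependent_iff_notMem_convexHull_image_compl] at h
    push Not at h
    obtain ⟨k, hk⟩ := h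
    linarith [four_le_perimeter hP hk]

theorem four_le_perimeter_of_nonempty_reflexVertices {P : Pentagon} (hP : volume P.region = 1)
    (h : P.reflexVertices.Nonempty) : 4 ≤ perimeter P.poly :=
  let ⟨_, hk⟩ := h
  four_le_perimeter hP (mem_convexHull_of_mem_reflexVertices hk)

theorem le_perimeter_of_nontrivial_reflexVertices {P : Pentagon} (hP : volume P.region = 1)
    (h : P.reflexVertices.Nontrivial) : 4.559 ≤ perimeter P.poly := by
  obtain ⟨i, hi, j, hj, hij⟩ := h
  refine le_perimeter_of_volume_convexHull_le hP (by positivity) ?_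
    (volume_convexHull_range_five_le_of_mem_of_mem P.vertices_injective hij
      (mem_convexHull_of_mem_reflexVertices hi) (mem_convexHull_of_mem_reflexVertices hj))
  have hsqrt : 1.73205 ≤ √3 := Real.le_sqrt_of_sq_le (by norm_num)
  norm_num
  linarith

end Pentagon

theorem lt_perimeter_cairo : 3.8637 < perimeter cairo := by
  have h₃ : 1.7320508 < √3 := Real.lt_sqrt_of_sq_lt (by norm_num)
  have h : 1.93185 < √(2 + √3) := Real.lt_sqrt_of_sq_lt (by norm_num; linarith)
  rw [perimeter_cairo]
  linarith

theorem perimeter_cairo_lt : perimeter cairo < 3.863705 := by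
  have h₃ : √3 < 1.7320509 := (Real.sqrt_lt' (by norm_num)).2 (by norm_num)
  have h : √(2 + √3) < 1.9318525 := (Real.sqrt_lt' (by norm_num)).2 (by norm_num; linarith)
  rw [perimeter_cairo]
  linarith

/-
The constant must lie between `perimeter cairo - 3.81182`, the largest deficit of an efficient
pentagon, and both `(4 - perimeter cairo) / 2.6` and `(4.559 - perimeter cairo) / 13.4`.
-/
open Classical in
theorem Pentagon.le_perimeter_sub_perimeter_cairo {P : Pentagon} (hP : volume P.region = 1)
    {S₁ S₂ : Prop} (h₁ : S₁ → P.reflexVertices.Nonempty) (h₂ : S₂ → P.reflexVertices.Nontrivial)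
    (hdisj : S₁ → ¬ S₂) :
    0.051885 * (2.6 * (if S₁ then 1 else 0) + 13.4 * (if S₂ then 1 else 0)
      - (if P.IsEfficient then 1 else 0)) ≤ perimeter P.poly - perimeter cairo := by
  have hlt := lt_perimeter_cairo
  have hgt := perimeter_cairo_lt
  by_cases hS₁ : S₁
  · have hperimeter := four_le_perimeter_of_nonempty_reflexVertices hP (h₁ hS₁)
    have heff : ¬ P.IsEfficient := fun h => by linarith [h.2]
    simp only [hS₁, hdisj hS₁, heff, if_true, if_false]
    linarith
  by_cases hS₂ : S₂
  · have hperimeter := le_perimeter_of_nontrivial_reflexVertices hP (h₂ hS₂)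
    have heff : ¬ P.IsEfficient := fun h => by linarith [h.2]
    simp only [hS₁, hS₂, heff, if_true, if_false]
    linarith
  by_cases heff : P.IsEfficient
  · have hperimeter := le_perimeter hP
    simp only [hS₁, hS₂, heff, if_true, if_false]
    linarith
  · have hperimeter : perimeter cairo < perimeter P.poly := not_le.1 fun h => heff ⟨hP, h⟩
    simp only [hS₁, hS₂, heff, if_false]
    linarith

/-! ### Boundaries of pentagons -/

theorem volume_segment_eq_zero (a b : ℂ) : volume (segment ℝ a b) = 0 := by
  have h := volume_convexHull_triple_le a a b
  rwa [insert_eq_of_mem (by simp), convexHull_pair, show cross a a b = 0 by simp [cross], abs_zero,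
    zero_div, ENNReal.ofReal_zero, nonpos_iff_eq_zero] at h

theorem isClosed_edgeSet {n : ℕ} (P : Polygon ℂ n) (i : Fin n) : IsClosed (P.edgeSet ℝ i) := by
  rw [edgeSet_eq_segment, ← convexHull_pair]
  exact (toFinite _).isClosed_convexHull ℝ

theorem isPreconnected_boundary {n : ℕ} [NeZero n] (P : Polygon ℂ n) :
    IsPreconnected (P.boundary ℝ) := by
  obtain ⟨m, rfl⟩ := Nat.exists_eq_succ_of_ne_zero (NeZero.ne n)
  rw [boundary_eq_iUnion_segment]
  refine IsPreconnected.iUnion_of_chain (fun i => (convex_segment _ _).isPreconnected) fun i => ?_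
  refine ⟨P (finRotate _ i), right_mem_segment ℝ _ _, ?_⟩
  cases i using Fin.lastCases with
  | last =>
    rw [Fin.orderSucc_last]
    exact right_mem_segment ℝ _ _
  | cast i =>
    have hnext : finRotate (m + 1) i.castSucc = i.succ := by
      rw [finRotate_apply, Fin.coeSucc_eq_succ]
    rw [Fin.orderSucc_castSucc, hnext]
    exact left_mem_segment ℝ _ _

namespace Pentagon

theorem boundary_subset_region (P : Pentagon) : P.poly.boundary ℝ ⊆ P.region :=
  P.frontier_region ▸ P.isCompact_region.isClosed.frontier_subset

theorem isClosed_boundary (P : Pentagon) : IsClosed (P.poly.boundary ℝ) :=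
  P.frontier_region ▸ isClosed_frontier

theorem volume_interior_region (P : Pentagon) : volume (interior P.region) = volume P.region := by
  refine measure_interior_of_null_frontier ?_
  rw [P.frontier_region, boundary_eq_iUnion_segment]
  exact measure_iUnion_null fun i => volume_segment_eq_zero _ _

theorem eq_of_mem_edgeSet {P : Pentagon} {p : ℂ} (hp : ∀ k, p ≠ P.poly k) {i j : Fin 5}
    (hi : p ∈ P.poly.edgeSet ℝ i) (hj : p ∈ P.poly.edgeSet ℝ j) : i = j := by
  by_contra hij
  rcases (P.simple i j hij ⟨hi, hj⟩).1 with h | h <;> exact hp _ h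

theorem perimeter_le_hausdorffMeasure_boundary (P : Pentagon) :
    ENNReal.ofReal (perimeter P.poly) ≤ μH[1] (P.poly.boundary ℝ) := by
  have : NullSingletonClass (μH[1] : Measure ℂ) := Measure.nullSingletonClass_hausdorff ℂ one_pos
  rw [Polygon.boundary, measure_iUnion₀, tsum_fintype, perimeter,
    ENNReal.ofReal_sum_of_nonneg fun _ _ => dist_nonneg]
  · refine Finset.sum_le_sum fun i _ => ?_
    rw [edgeSet_eq_segment, hausdorffMeasure_segment, edist_dist]
  · exact fun i j hij => measure_mono_null (P.simple i j hij)
      (((toFinite _).inter_of_left _).measure_zero _)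
  · exact fun i => (isClosed_edgeSet P.poly i).measurableSet.nullMeasurableSet

end Pentagon

/-! ### The two sides of an edge -/

theorem continuous_cross (a b : ℂ) : Continuous (cross a b) := by
  unfold cross
  fun_prop

theorem cross_eq_zero_of_mem_segment {a b x : ℂ} (hx : x ∈ segment ℝ a b) : cross a b x = 0 := by
  obtain ⟨s, t, -, -, hst, rfl⟩ := hx
  rw [cross_smul_add_smul _ _ _ _ hst]
  simp only [cross]
  ring

theorem isOpenMap_cross {a b : ℂ} (hab : a ≠ b) : IsOpenMap (cross a b) := by
  set v : ℂ := Complex.I * (b - a)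
  have hcross : cross a b = innerₛₗ ℝ v ∘ fun x => x - a := by
    ext x
    simp [cross, v, Complex.inner]
    ring
  have hv : innerₛₗ ℝ v ≠ 0 := by
    intro h
    have : inner ℝ v v = 0 := DFunLike.congr_fun h v
    simp [v, sub_eq_zero, hab.symm] at this
  rw [hcross]
  exact (LinearMap.isOpenMap_of_finiteDimensional _ (LinearMap.surjective hv)).comp
    (isOpenMap_sub_right a)

theorem mem_closure_preimage_cross {a b p : ℂ} (hab : a ≠ b) {s : Set ℝ}
    (h : cross a b p ∈ closure s) : p ∈ closure (cross a b ⁻¹' s) :=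
  (isOpenMap_cross hab).preimage_closure_subset_closure_preimage h

theorem inter_frontier_nonempty {X : Type*} [TopologicalSpace X] {s t : Set X}
    (hs : IsPreconnected s) (h : (s ∩ t).Nonempty) (h' : (s ∩ tᶜ).Nonempty) :
    (s ∩ frontier t).Nonempty := by
  by_contra hne
  have hcover : s ⊆ interior t ∪ interior tᶜ := by
    rw [← compl_frontier_eq_union_interior]
    exact fun x hx hxt => hne ⟨x, hx, hxt⟩
  have hinterior {u : Set X} (hu : (s ∩ u).Nonempty) (hsu : s ⊆ interior u ∪ interior uᶜ) :
      (s ∩ interior u).Nonempty := by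
    obtain ⟨x, hxs, hxu⟩ := hu
    exact ⟨x, hxs, (hsu hxs).resolve_right fun h => interior_subset h hxu⟩
  obtain ⟨x, -, hx, hx'⟩ := hs _ _ isOpen_interior isOpen_interior hcover (hinterior h hcover)
    (hinterior h' (by rwa [compl_compl, union_comm]))
  exact interior_subset hx' (interior_subset hx)

theorem subset_interior_of_disjoint_frontier {X : Type*} [TopologicalSpace X] {s t : Set X}
    (hs : IsPreconnected s) (hopen : IsOpen s) (hdisj : Disjoint s (frontier t))
    (h : (s ∩ t).Nonempty) : s ⊆ interior t := by
  refine interior_maximal (fun x hx => ?_) hopen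
  by_contra hxt
  obtain ⟨y, hy, hyt⟩ := inter_frontier_nonempty hs h ⟨x, hx, hxt⟩
  exact disjoint_left.1 hdisj hy hyt

namespace Pentagon

theorem eventually_mem_edgeSet_of_mem_frontier {P : Pentagon} {p : ℂ} (hp : ∀ k, p ≠ P.poly k)
    {k : Fin 5} (hpk : p ∈ P.poly.edgeSet ℝ k) :
    ∀ᶠ x in 𝓝 p, x ∈ frontier P.region → x ∈ P.poly.edgeSet ℝ k := by
  have hother (j : Fin 5) : ∀ᶠ x in 𝓝 p, x ∈ P.poly.edgeSet ℝ j → j = k := by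
    by_cases hpj : p ∈ P.poly.edgeSet ℝ j
    · exact .of_forall fun _ _ => eq_of_mem_edgeSet hp hpj hpk
    · filter_upwards [(isClosed_edgeSet P.poly j).isOpen_compl.mem_nhds hpj] with x hx hxj
      exact absurd hxj hx
  filter_upwards [eventually_all.2 hother] with x hx hxf
  rw [P.frontier_region, Polygon.boundary, mem_iUnion] at hxf
  obtain ⟨j, hj⟩ := hxf
  exact hx j hj ▸ hj

theorem exists_cross_ne_zero {P : Pentagon} {a b p : ℂ} (hab : a ≠ b) (hp : p ∈ P.region)
    {U : Set ℂ} (hU : U ∈ 𝓝 p) : ∃ x ∈ U ∩ P.region, cross a b x ≠ 0 := by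
  rw [← P.closure_interior_region] at hp
  obtain ⟨x, hxU, hx⟩ := mem_closure_iff_nhds.1 hp _ (interior_mem_nhds.2 hU)
  have hV : interior U ∩ interior P.region ∈ 𝓝 x :=
    (isOpen_interior.inter isOpen_interior).mem_nhds ⟨hxU, hx⟩
  obtain ⟨y, hy, hy0⟩ := mem_closure_iff_nhds.1
    (mem_closure_preimage_cross (p := x) (s := {0}ᶜ) hab (by simp)) _ hV
  exact ⟨y, inter_subset_inter interior_subset interior_subset hy, hy0⟩

theorem interior_region_mem_nhdsWithin {P : Pentagon} {a b p : ℂ} {k : Fin 5} (hab : a ≠ b)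
    (hp : ∀ k, p ≠ P.poly k) (hk : P.poly.edgeSet ℝ k = segment ℝ a b)
    (hpk : p ∈ P.poly.edgeSet ℝ k) :
    interior P.region ∈ 𝓝[cross a b ⁻¹' Ioi 0] p ∨
      interior P.region ∈ 𝓝[cross a b ⁻¹' Iio 0] p := by
  obtain ⟨r, hr, hfrontier⟩ :=
    Metric.eventually_nhds_iff_ball.1 (eventually_mem_edgeSet_of_mem_frontier hp hpk)
  have hside {s : Set ℝ} (hs : Convex ℝ s) (hopen : IsOpen s) (h0 : 0 ∉ s)
      (hinter : (Metric.ball p r ∩ cross a b ⁻¹' s ∩ P.region).Nonempty) :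
      interior P.region ∈ 𝓝[cross a b ⁻¹' s] p := by
    refine mem_of_superset (inter_mem (mem_nhdsWithin_of_mem_nhds (Metric.ball_mem_nhds p hr))
      self_mem_nhdsWithin) (subset_interior_of_disjoint_frontier
        ((convex_ball p r).inter (convex_setOf_cross_mem a b hs)).isPreconnected
        (Metric.isOpen_ball.inter (hopen.preimage (continuous_cross a b)))
        (disjoint_left.2 ?_) hinter)
    rintro x ⟨hx, hxs⟩ hxf
    rw [mem_preimage, cross_eq_zero_of_mem_segment (hk ▸ hfrontier x hx hxf)] at hxs
    exact h0 hxs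
  have hpP : p ∈ P.region := P.boundary_subset_region (mem_iUnion.2 ⟨k, hpk⟩)
  obtain ⟨x, ⟨hx, hxP⟩, hx0⟩ := exists_cross_ne_zero hab hpP (Metric.ball_mem_nhds p hr)
  rcases lt_or_gt_of_ne hx0 with h | h
  · exact Or.inr (hside (convex_Iio 0) isOpen_Iio self_notMem_Iio ⟨x, ⟨hx, h⟩, hxP⟩)
  · exact Or.inl (hside (convex_Ioi 0) isOpen_Ioi self_notMem_Ioi ⟨x, ⟨hx, h⟩, hxP⟩)

end Pentagon

/-! ### Multiplicity of the boundaries of the tiles -/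

theorem tsum_measure_le_mul_measure_iUnion {ι α : Type*} [Countable ι] [MeasurableSpace α]
    {μ : Measure α} {A : ι → Set α} (hA : ∀ i, MeasurableSet (A i)) {m : ℕ∞}
    (h : ∀ᵐ x ∂μ, {i | x ∈ A i}.encard ≤ m) : ∑' i, μ (A i) ≤ m * μ (⋃ i, A i) := by
  have hmultiplicity (x : α) :
      ∑' i, (A i).indicator (1 : α → ℝ≥0∞) x = ({i | x ∈ A i}.encard : ℝ≥0∞) := by
    rw [← ENNReal.tsum_set_one, tsum_subtype {i | x ∈ A i} fun _ => (1 : ℝ≥0∞)]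
    rfl
  calc ∑' i, μ (A i)
      = ∫⁻ x, ∑' i, (A i).indicator 1 x ∂μ := by
        rw [lintegral_tsum fun i => (measurable_one.indicator (hA i)).aemeasurable]
        simp only [lintegral_indicator_one (hA _)]
    _ ≤ ∫⁻ x, m * (⋃ i, A i).indicator 1 x ∂μ := by
        refine lintegral_mono_ae ?_
        filter_upwards [h] with x hx
        rw [hmultiplicity]
        by_cases hmem : x ∈ ⋃ i, A i
        · simpa [hmem] using hx
        · simp_all
    _ = m * μ (⋃ i, A i) := by
        have hunion : MeasurableSet (⋃ i, A i) := .iUnion hA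
        rw [lintegral_const_mul _ (measurable_one.indicator hunion),
          lintegral_indicator_one hunion]

namespace PentagonTiling

theorem volume_interior_tile {ι : Type*} (T : PentagonTiling ι) (i : ι) :
    volume (interior (T.tile i).region) = 1 :=
  (T.tile i).volume_interior_region.trans (T.unit_area i)

theorem countable {ι : Type*} (T : PentagonTiling ι) : Countable ι := by
  refine countable_univ_iff.1 (PairwiseDisjoint.countable_of_isOpen
    (fun i _ j _ hij => T.disjoint_interiors i j hij) (fun i _ => isOpen_interior) fun i _ => ?_)
  refine nonempty_of_measure_ne_zero (μ := volume) ?_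
  rw [T.volume_interior_tile]
  exact one_ne_zero

variable {ι : Type*} (T : PentagonTiling ι)

theorem subsingleton_setOf_interior_mem (f : Filter ℂ) [NeBot f] :
    {i | interior (T.tile i).region ∈ f}.Subsingleton := by
  intro i hi j hj
  by_contra hij
  obtain ⟨x, hxi, hxj⟩ := f.nonempty_of_mem (inter_mem hi hj)
  exact disjoint_left.1 (T.disjoint_interiors i j hij) hxi hxj

theorem exists_edgeSet_eq {p : ℂ} {i j : ι} {k : Fin 5} (hp : ∀ k, p ≠ (T.tile i).poly k)
    (hi : p ∈ (T.tile i).poly.edgeSet ℝ k) (hj : p ∈ (T.tile j).poly.boundary ℝ) :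
    ∃ l, (T.tile j).poly.edgeSet ℝ l = (T.tile i).poly.edgeSet ℝ k := by
  rcases eq_or_ne i j with rfl | hij
  · exact ⟨k, rfl⟩
  have hregion := (T.tile i).boundary_subset_region (mem_iUnion.2 ⟨k, hi⟩)
  rcases T.edge_to_edge i j hij p ⟨hregion, (T.tile j).boundary_subset_region hj⟩ with
    ⟨k', -, hk', -⟩ | ⟨k', l, hkl, hk'⟩
  · exact absurd hk'.symm (hp k')
  · exact ⟨l, Pentagon.eq_of_mem_edgeSet hp hi hk' ▸ hkl.symm⟩

theorem encard_setOf_mem_boundary_le {p : ℂ} (hp : ∀ i k, p ≠ (T.tile i).poly k) :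
    {i | p ∈ (T.tile i).poly.boundary ℝ}.encard ≤ 2 := by
  rcases {i | p ∈ (T.tile i).poly.boundary ℝ}.eq_empty_or_nonempty with hempty | ⟨i, hi⟩
  · simp [hempty]
  obtain ⟨k, hk⟩ := mem_iUnion.1 hi
  set a := (T.tile i).poly k
  set b := (T.tile i).poly (finRotate 5 k)
  have hab : a ≠ b := (T.tile i).vertices_injective.ne (by simp)
  have hpab : p ∈ segment ℝ a b := edgeSet_eq_segment _ k ▸ hk
  have hsub : {i | p ∈ (T.tile i).poly.boundary ℝ} ⊆
      {j | interior (T.tile j).region ∈ 𝓝[cross a b ⁻¹' Ioi 0] p} ∪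
        {j | interior (T.tile j).region ∈ 𝓝[cross a b ⁻¹' Iio 0] p} := by
    intro j hj
    obtain ⟨l, hl⟩ := T.exists_edgeSet_eq (hp i) hk hj
    rw [edgeSet_eq_segment (T.tile i).poly] at hl
    exact Pentagon.interior_region_mem_nhdsWithin hab (hp j) hl (hl ▸ hpab)
  have hleft : NeBot (𝓝[cross a b ⁻¹' Ioi 0] p) := mem_closure_iff_nhdsWithin_neBot.1
    (mem_closure_preimage_cross hab (by simp [cross_eq_zero_of_mem_segment hpab]))
  have hright : NeBot (𝓝[cross a b ⁻¹' Iio 0] p) := mem_closure_iff_nhdsWithin_neBot.1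
    (mem_closure_preimage_cross hab (by simp [cross_eq_zero_of_mem_segment hpab]))
  refine (encard_le_encard hsub).trans ((encard_union_le _ _).trans ?_)
  rw [← one_add_one_eq_two]
  exact add_le_add (encard_le_one_iff_subsingleton.2 (T.subsingleton_setOf_interior_mem _))
    (encard_le_one_iff_subsingleton.2 (T.subsingleton_setOf_interior_mem _))

theorem tsum_hausdorffMeasure_boundary_inter_le {A : Set ℂ} (hA : MeasurableSet A) :
    ∑' i, μH[1] ((T.tile i).poly.boundary ℝ ∩ A) ≤ 2 * μH[1] (T.skeleton ∩ A) := by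
  have := T.countable
  have : NullSingletonClass (μH[1] : Measure ℂ) := Measure.nullSingletonClass_hausdorff ℂ one_pos
  have hvertices : (⋃ i, range (T.tile i).poly.vertices).Countable :=
    countable_iUnion fun i => (finite_range _).countable
  rw [skeleton, iUnion_inter]
  refine tsum_measure_le_mul_measure_iUnion (m := 2)
    (fun i => (T.tile i).isClosed_boundary.measurableSet.inter hA) ?_
  filter_upwards [hvertices.ae_notMem μH[1]] with p hp
  refine (encard_le_encard fun i hi => hi.1).trans (T.encard_setOf_mem_boundary_le fun i k h => ?_)
  exact hp (mem_iUnion.2 ⟨i, k, h.symm⟩)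

end PentagonTiling

/-! ### Tiles in a large disk -/

theorem ofReal_sub_le_hausdorffMeasure_inter_closedBall {E : Type*} [NormedAddCommGroup E]
    [MeasurableSpace E] [BorelSpace E] {s : Set E} (hs : IsPreconnected s) {u v : E} (hu : u ∈ s)
    (hv : v ∈ s) {r R : ℝ} (hur : ‖u‖ ≤ r) (hRv : R ≤ ‖v‖) :
    ENNReal.ofReal (R - r) ≤ μH[1] (s ∩ Metric.closedBall 0 R) := by
  have himage : Icc r R ⊆ norm '' (s ∩ Metric.closedBall 0 R) := by
    intro t ht
    obtain ⟨w, hw, rfl⟩ := (hs.image _ continuous_norm.continuousOn).Icc_subset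
      (mem_image_of_mem _ hu) (mem_image_of_mem _ hv) (Icc_subset_Icc hur hRv ht)
    exact ⟨w, ⟨hw, mem_closedBall_zero_iff.2 ht.2⟩, rfl⟩
  calc ENNReal.ofReal (R - r) = μH[1] (Icc r R) := by
        rw [hausdorffMeasure_real, Real.volume_Icc]
    _ ≤ μH[1] (norm '' (s ∩ Metric.closedBall 0 R)) := measure_mono himage
    _ ≤ μH[1] (s ∩ Metric.closedBall 0 R) := by
        simpa using (lipschitzWith_one_norm (E := E)).hausdorffMeasure_image_le zero_le_one
          (s ∩ Metric.closedBall 0 R)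

theorem Pentagon.ofReal_sub_le_hausdorffMeasure_boundary_inter_closedBall {P : Pentagon} {r R : ℝ}
    (hvolume : volume P.region < volume (Metric.ball (0 : ℂ) r))
    (hr : (P.region ∩ Metric.ball 0 r).Nonempty) (hR : ¬ P.region ⊆ Metric.closedBall 0 R) :
    ENNReal.ofReal (R - r) ≤ μH[1] (P.poly.boundary ℝ ∩ Metric.closedBall 0 R) := by
  rcases lt_or_ge R 0 with hneg | hnonneg
  · have hr0 : 0 < r := Metric.nonempty_ball.1 hr.right
    rw [ENNReal.ofReal_of_nonpos (by linarith)]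
    exact zero_le
  obtain ⟨u, hur, hu⟩ : (Metric.ball (0 : ℂ) r ∩ frontier P.region).Nonempty := by
    refine inter_frontier_nonempty (convex_ball 0 r).isPreconnected (inter_comm _ _ ▸ hr) ?_
    by_contra hempty
    rw [not_nonempty_iff_eq_empty, ← sdiff_eq, sdiff_eq_empty] at hempty
    exact (measure_mono hempty).not_gt hvolume
  obtain ⟨v, hv, hRv⟩ : ∃ v ∈ frontier P.region, R < ‖v‖ := by
    by_contra! h
    exact hR (subset_of_frontier_subset P.isCompact_region Metric.isClosed_closedBall
      (convex_closedBall 0 R) (Metric.nonempty_closedBall.2 hnonneg)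
      fun v hv => mem_closedBall_zero_iff.2 (h v hv))
  rw [P.frontier_region] at hu hv
  exact ofReal_sub_le_hausdorffMeasure_inter_closedBall (isPreconnected_boundary P.poly) hu hv
    (mem_ball_zero_iff.1 hur).le hRv.le

theorem eventually_mul_sq_le_mul_sub_sq {a b : ℝ} (hab : a < b) (d : ℝ) :
    ∀ᶠ R : ℝ in atTop, a * R ^ 2 ≤ b * (R - d) ^ 2 := by
  have h : Tendsto (fun R : ℝ => b * (1 - d / R) ^ 2) atTop (𝓝 (b * (1 - 0) ^ 2)) :=
    ((tendsto_const_nhds.sub (tendsto_const_nhds.div_atTop tendsto_id)).pow 2).const_mul b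
  filter_upwards [h.eventually_const_lt (by simpa using hab), eventually_ne_atTop 0] with R hR hR0
  calc a * R ^ 2 ≤ b * (1 - d / R) ^ 2 * R ^ 2 := by gcongr
    _ = b * (R - d) ^ 2 := by field_simp

namespace PentagonTiling

variable {ι : Type*} (T : PentagonTiling ι)

/-- The tiles that meet the open disk of radius `r` about the origin but are not completely inside
the closed disk of radius `R`: the only tiles meeting the smaller disk that `T.inside R` misses. -/
def crossing (r R : ℝ) : Set ι :=
  {i | ((T.tile i).region ∩ Metric.ball 0 r).Nonempty} \ T.inside R

theorem disjoint_inside_crossing (r R : ℝ) : Disjoint (T.inside R) (T.crossing r R) :=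
  disjoint_sdiff_right

theorem volume_ball_le_encard_add_encard (r R : ℝ) :
    volume (Metric.ball (0 : ℂ) r) ≤ (T.inside R).encard + (T.crossing r R).encard := by
  have := T.countable
  have hcover : Metric.ball (0 : ℂ) r ⊆ ⋃ i ∈ T.inside R ∪ T.crossing r R, (T.tile i).region := by
    intro x hx
    obtain ⟨i, hi⟩ := mem_iUnion.1 (T.cover ▸ mem_univ x)
    refine mem_biUnion ?_ hi
    rw [crossing, union_sdiff_self]
    exact Or.inr ⟨x, hi, hx⟩
  calc volume (Metric.ball (0 : ℂ) r)
      ≤ ∑' i : ↥(T.inside R ∪ T.crossing r R), volume (T.tile i).region :=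
        (measure_mono hcover).trans (measure_biUnion_le _ (to_countable _) _)
    _ = (T.inside R).encard + (T.crossing r R).encard := by
        simp only [T.unit_area, ENNReal.tsum_set_one,
          encard_union_eq (T.disjoint_inside_crossing r R), ENat.toENNReal_add]

theorem tsum_perimeter_add_mul_encard_le {r : ℝ} (hr : 1 ≤ r) (R : ℝ) :
    ∑' i : T.inside R, ENNReal.ofReal (perimeter (T.tile i).poly)
      + ENNReal.ofReal (R - r) * (T.crossing r R).encard
      ≤ 2 * μH[1] (T.skeleton ∩ Metric.closedBall 0 R) := by
  set length : ι → ℝ≥0∞ := fun i => μH[1] ((T.tile i).poly.boundary ℝ ∩ Metric.closedBall 0 R)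
  have hinside (i : T.inside R) : ENNReal.ofReal (perimeter (T.tile i).poly) ≤ length i := by
    simp only [length]
    rw [inter_eq_left.2 ((T.tile i).boundary_subset_region.trans i.2)]
    exact (T.tile i).perimeter_le_hausdorffMeasure_boundary
  have hdisk : 1 < volume (Metric.ball (0 : ℂ) r) := by
    rw [Complex.volume_ball, ← ENNReal.ofReal_coe_nnreal (p := NNReal.pi), NNReal.coe_real_pi]
    exact one_lt_mul_of_le_of_lt (one_le_pow₀ (ENNReal.one_le_ofReal.2 hr))
      (ENNReal.one_lt_ofReal.2 (by linarith [Real.pi_gt_three]))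
  have hcrossing (i : T.crossing r R) : ENNReal.ofReal (R - r) ≤ length i :=
    Pentagon.ofReal_sub_le_hausdorffMeasure_boundary_inter_closedBall
      ((T.unit_area i).trans_lt hdisk) i.2.1 i.2.2
  calc _ ≤ ∑' i : T.inside R, length i + ∑' i : T.crossing r R, length i := by
        rw [mul_comm, ← ENNReal.tsum_set_const]
        exact add_le_add (ENNReal.tsum_le_tsum hinside) (ENNReal.tsum_le_tsum hcrossing)
    _ = ∑' i : ↥(T.inside R ∪ T.crossing r R), length i :=
        (ENNReal.summable.tsum_union_disjoint (T.disjoint_inside_crossing r R)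
          ENNReal.summable).symm
    _ ≤ ∑' i, length i := ENNReal.tsum_comp_le_tsum_of_injective Subtype.val_injective length
    _ ≤ _ := T.tsum_hausdorffMeasure_boundary_inter_le Metric.isClosed_closedBall.measurableSet

theorem eventually_hausdorffMeasure_le {a : ℝ≥0∞} (ha : T.perimeterRatio < a) :
    ∀ᶠ R : ℝ in atTop, μH[1] (T.skeleton ∩ Metric.closedBall 0 R) ≤
      a * ENNReal.ofReal (π * R ^ 2) := by
  filter_upwards [eventually_lt_of_limsup_lt ha, eventually_gt_atTop 0] with R hR hR0
  have hpos : 0 < π * R ^ 2 := by positivity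
  exact (ENNReal.div_le_iff (ENNReal.ofReal_pos.2 hpos).ne' ENNReal.ofReal_ne_top).1 hR.le

theorem eventually_tsum_perimeter_le {l : ℝ} (hl : T.perimeterRatio < ENNReal.ofReal (l / 2)) :
    ∀ᶠ R : ℝ in atTop, ∑' i : T.inside R, ENNReal.ofReal (perimeter (T.tile i).poly) ≤
      ENNReal.ofReal l * (T.inside R).encard := by
  obtain ⟨a, ha, hTa, hal⟩ := ENNReal.lt_iff_exists_real_btwn.1 hl
  have hal : 2 * a < l := by linarith [(ENNReal.ofReal_lt_ofReal_iff_of_nonneg ha).1 hal]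
  filter_upwards [T.eventually_hausdorffMeasure_le hTa, eventually_mul_sq_le_mul_sub_sq hal l,
    eventually_ge_atTop (l + 1)] with R hR hsq hlR
  have hcount := T.tsum_perimeter_add_mul_encard_le (r := R - l) (by linarith) R
  rw [sub_sub_cancel] at hcount
  have hlength : 2 * μH[1] (T.skeleton ∩ Metric.closedBall 0 R) ≤
      ENNReal.ofReal (π * (2 * a * R ^ 2)) := by
    calc _ ≤ 2 * (ENNReal.ofReal a * ENNReal.ofReal (π * R ^ 2)) := by gcongr
      _ = ENNReal.ofReal (π * (2 * a * R ^ 2)) := by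
        rw [← ENNReal.ofReal_mul ha, ← ENNReal.ofReal_ofNat, ← ENNReal.ofReal_mul zero_le_two]
        ring_nf
  have hfinite : ENNReal.ofReal l * (T.crossing (R - l) R).encard ≠ ∞ := ne_top_of_le_ne_top
    ENNReal.ofReal_ne_top (le_add_self.trans (hcount.trans hlength))
  refine (ENNReal.add_le_add_iff_right hfinite).1 (hcount.trans ?_)
  calc _ ≤ ENNReal.ofReal (π * (2 * a * R ^ 2)) := hlength
    _ ≤ ENNReal.ofReal (l * ((R - l) ^ 2 * π)) := by
        refine ENNReal.ofReal_le_ofReal ?_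
        linarith [mul_le_mul_of_nonneg_left hsq Real.pi_nonneg]
    _ = ENNReal.ofReal l * volume (Metric.ball (0 : ℂ) (R - l)) := by
        rw [Complex.volume_ball, ENNReal.ofReal_mul (by linarith),
          ENNReal.ofReal_mul (by positivity), ENNReal.ofReal_pow (by linarith),
          ← ENNReal.ofReal_coe_nnreal (p := NNReal.pi), NNReal.coe_real_pi]
    _ ≤ _ := by
        rw [← mul_add]
        gcongr
        exact T.volume_ball_le_encard_add_encard _ _

end PentagonTiling

/-! ### Fractions of tiles -/

namespace Pentagon

theorem IsType1.nonempty_reflexVertices {P : Pentagon} (h : P.IsType1) :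
    P.reflexVertices.Nonempty := by
  obtain ⟨j, hj⟩ := h.2
  rw [reflexVertices, hj]
  exact singleton_nonempty j

theorem IsType2.nontrivial_reflexVertices {P : Pentagon} (h : P.IsType2) :
    P.reflexVertices.Nontrivial := by
  obtain ⟨i, j, hij, hset, -⟩ := h.2
  rw [reflexVertices, hset]
  exact nontrivial_pair hij

theorem IsType1.not_isType2 {P : Pentagon} (h : P.IsType1) : ¬ P.IsType2 := by
  intro h₂
  obtain ⟨j, hj⟩ := h.2
  have htwo := h₂.nontrivial_reflexVertices
  rw [reflexVertices, hj] at htwo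
  exact not_nontrivial_singleton htwo

end Pentagon

theorem perimeter_nonneg {n : ℕ} (P : Polygon ℂ n) : 0 ≤ perimeter P :=
  Finset.sum_nonneg fun _ _ => dist_nonneg

namespace PentagonTiling

variable {ι : Type*} (T : PentagonTiling ι)

theorem finite_inside (R : ℝ) : (T.inside R).Finite := by
  refine (Measure.finite_const_le_meas_of_disjoint_iUnion (ι := T.inside R) volume one_pos
    (As := fun i => interior (T.tile i).region) (fun i => isOpen_interior.measurableSet)
    (fun i j hij => T.disjoint_interiors i j (Subtype.coe_ne_coe.2 hij)) ?_).subset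
    (fun i _ => (T.volume_interior_tile i).ge) |> fun h => finite_coe_iff.1 (finite_univ_iff.1 h)
  exact ne_top_of_le_ne_top (measure_closedBall_lt_top (x := (0 : ℂ)) (r := R)).ne
    (measure_mono (iUnion_subset fun i => interior_subset.trans i.2))

theorem fraction_nonneg (S : Pentagon → Prop) (R : ℝ) : 0 ≤ T.fraction S R := by
  unfold fraction
  positivity

theorem fraction_le_one (S : Pentagon → Prop) (R : ℝ) : T.fraction S R ≤ 1 :=
  div_le_one_of_le₀ (mod_cast ncard_le_ncard (sep_subset _ _) (T.finite_inside R)) (by positivity)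

open Classical in
theorem fraction_mul_ncard (S : Pentagon → Prop) (R : ℝ) :
    T.fraction S R * (T.inside R).ncard =
      ∑ i ∈ (T.finite_inside R).toFinset, if S (T.tile i) then (1 : ℝ) else 0 := by
  have hsep : {i ∈ T.inside R | S (T.tile i)} =
      ((T.finite_inside R).toFinset.filter fun i => S (T.tile i) : Set ι) := by
    simp
  rw [fraction, div_mul_cancel_of_imp, Finset.sum_boole, hsep, ncard_coe_finset]
  intro h
  exact_mod_cast Nat.eq_zero_of_le_zero
    ((ncard_le_ncard (sep_subset _ _) (T.finite_inside R)).trans (Nat.cast_eq_zero.1 h).le)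

theorem mul_fraction_mul_ncard_le_sum_perimeter_sub {S₁ S₂ : Pentagon → Prop}
    (h₁ : ∀ P, S₁ P → P.reflexVertices.Nonempty)
    (h₂ : ∀ P, S₂ P → P.reflexVertices.Nontrivial) (hdisj : ∀ P, S₁ P → ¬ S₂ P) (R : ℝ) :
    0.051885 * ((2.6 * T.fraction S₁ R + 13.4 * T.fraction S₂ R
        - T.fraction Pentagon.IsEfficient R) * (T.inside R).ncard) ≤
      ∑ i ∈ (T.finite_inside R).toFinset, perimeter (T.tile i).poly
        - perimeter cairo * (T.inside R).ncard := by
  have hsum := Finset.sum_le_sum fun i (_ : i ∈ (T.finite_inside R).toFinset) =>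
    Pentagon.le_perimeter_sub_perimeter_cairo (T.unit_area i) (h₁ (T.tile i)) (h₂ (T.tile i))
      (hdisj (T.tile i))
  rw [← Finset.mul_sum, Finset.sum_sub_distrib, Finset.sum_add_distrib, ← Finset.mul_sum,
    ← Finset.mul_sum, ← fraction_mul_ncard, ← fraction_mul_ncard, ← fraction_mul_ncard,
    Finset.sum_sub_distrib, Finset.sum_const, nsmul_eq_mul,
    ← ncard_eq_toFinset_card _ (T.finite_inside R)] at hsum
  linarith

theorem eventually_sum_perimeter_le {l : ℝ} (hl : T.perimeterRatio < ENNReal.ofReal (l / 2)) :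
    ∀ᶠ R : ℝ in atTop, ∑ i ∈ (T.finite_inside R).toFinset, perimeter (T.tile i).poly ≤
      l * (T.inside R).ncard := by
  have hl0 : 0 < l / 2 := ENNReal.ofReal_pos.1 hl.bot_lt
  filter_upwards [T.eventually_tsum_perimeter_le hl] with R hR
  have hfin := T.finite_inside R
  rw [← hfin.cast_ncard_eq, ← hfin.coe_toFinset, Finset.tsum_subtype' _
    fun i => ENNReal.ofReal (perimeter (T.tile i).poly), hfin.coe_toFinset,
    ← ENNReal.ofReal_sum_of_nonneg fun i _ => perimeter_nonneg _, ENat.toENNReal_coe,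
    ← ENNReal.ofReal_natCast, ← ENNReal.ofReal_mul (by linarith)] at hR
  exact (ENNReal.ofReal_le_ofReal_iff (mul_nonneg (by linarith) (Nat.cast_nonneg _))).1 hR

theorem eventually_neg_le_fraction_sub
    (hT : T.perimeterRatio ≤ ENNReal.ofReal (perimeter cairo / 2)) {S₁ S₂ : Pentagon → Prop}
    (h₁ : ∀ P, S₁ P → P.reflexVertices.Nonempty)
    (h₂ : ∀ P, S₂ P → P.reflexVertices.Nontrivial) (hdisj : ∀ P, S₁ P → ¬ S₂ P)
    {η : ℝ} (hη : 0 < η) :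
    ∀ᶠ R : ℝ in atTop, -η ≤ T.fraction Pentagon.IsEfficient R - 2.6 * T.fraction S₁ R
      - 13.4 * T.fraction S₂ R := by
  have hcairo : 0 < perimeter cairo := by linarith [lt_perimeter_cairo]
  have hl : T.perimeterRatio < ENNReal.ofReal ((perimeter cairo + 0.051885 * η) / 2) :=
    hT.trans_lt ((ENNReal.ofReal_lt_ofReal_iff (by positivity)).2 (by linarith))
  filter_upwards [T.eventually_sum_perimeter_le hl] with R hR
  have hexcess := T.mul_fraction_mul_ncard_le_sum_perimeter_sub h₁ h₂ hdisj R
  rcases (T.inside R).ncard.eq_zero_or_pos with hempty | hpos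
  · simp [fraction, hempty, hη.le]
  · have hN : (0 : ℝ) < (T.inside R).ncard := Nat.cast_pos.2 hpos
    refine neg_le.1 (le_of_mul_le_mul_right ?_ hN)
    linarith

end PentagonTiling

end PentagonTilings

end

open PentagonTilings in
theorem proposition5p3_general {ι : Type*} (T : PentagonTiling ι)
    (hT : T.perimeterRatio ≤ ENNReal.ofReal (perimeter prismatic / 2))
    {S₁ S₂ : Pentagon → Prop} (h₁ : ∀ P, S₁ P → P.reflexVertices.Nonempty)
    (h₂ : ∀ P, S₂ P → P.reflexVertices.Nontrivial) (hdisj : ∀ P, S₁ P → ¬ S₂ P) :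
    0 ≤ liminf (fun R : ℝ => T.fraction Pentagon.IsEfficient R - 2.6 * T.fraction S₁ R
      - 13.4 * T.fraction S₂ R) atTop := by
  rw [perimeter_prismatic, ← perimeter_cairo] at hT
  refine le_of_forall_pos_le_add fun η hη => neg_le_iff_add_nonneg.1 (le_liminf_of_le
    (isCoboundedUnder_ge_of_le atTop (x := 1) fun R => ?_)
    (T.eventually_neg_le_fraction_sub hT h₁ h₂ hdisj hη))
  linarith [T.fraction_le_one Pentagon.IsEfficient R, T.fraction_nonneg S₁ R,
    T.fraction_nonneg S₂ R]

theorem proposition5p3 {ι : Type*} (T : PentagonTilings.PentagonTiling ι)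
    (hT : T.perimeterRatio ≤
      ENNReal.ofReal (PentagonTilings.perimeter PentagonTilings.prismatic / 2)) :
    0 ≤ liminf (fun R : ℝ =>
      T.fraction PentagonTilings.Pentagon.IsEfficient R
        - 2.6 * T.fraction PentagonTilings.Pentagon.IsType1 R
        - 13.4 * T.fraction PentagonTilings.Pentagon.IsType2 R) atTop :=
  proposition5p3_general T hT (fun _ h => h.nonempty_reflexVertices)
    (fun _ h => h.nontrivial_reflexVertices) fun _ h₁ h₂ => h₁.not_isType2 h₂
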